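/- Let $(Z,d_Z)$ be a compact metric space with $0<\operatorname{diam} Z<1$, equipped with a Borel measure $\nu$ that is doubling: there is a constant $C_d$ with $0<\nu(2B)\le C_d\,\nu(B)<\infty$ for all (open) balls $B$. Let $\alpha,\tau>1$, $z_0\in Z$, $A_0=\{z_0\}$, and let $A_0\subset A_1\subset A_2\subset\cdots\subset Z$ be such that each $A_n$ is a maximal $\alpha^{-n}$-separated set. The hyperbolic filling $X$ is the metric graph, with edges of length $1$, whose vertices are the pairs $(z,n)$ with $z\in A_n$, two distinct vertices $(x,n)$, $(y,m)$ being joined by an edge if and only if either $n=m$ and $B(x,\tau\alpha^{-n})\cap B(y,\tau\alpha^{-n})\ne\emptyset$, or $|n-m|=1$ and $B(x,\alpha^{-n})\cap B(y,\alpha^{-m})\neq\emptyset$. Let $v_0=(z_0,0)$ and $\varepsilon=\log\alpha$. The uniformization $X_\varepsilon$ is $X$ with the metric $$d_\varepsilon(x,y)=\inf_\gamma\int_\gamma e^{-\varepsilon d_X(\cdot,v_0)}\,ds,$$ the infimum being over rectifiable curves $\gamma$ in $X$ from $x$ to $y$; $\overline X_\varepsilon$ is its completion, and $Z$ is identified with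 $\overline X_\varepsilon\setminus X_\varepsilon$ through $\Psi(\zeta)=\lim_{n}(z_n,n)$, where $z_n\in A_n$ and $d_Z(z_n,\zeta)<\alpha^{-n}$. For $\beta>0$ put $w_\beta((z,n))=e^{-\beta n}\nu(B(z,\alpha^{-n}))$ and $$\mu_\beta(E)=\sum_{v}\sum_{w\sim v}\bigl(w_\beta(v)+w_\beta(w)\bigr)\,\mathcal L(E\cap[v,w]),$$ where $v,w$ range over the vertices of $X$ and $\mathcal L$ is Lebesgue measure on the unit interval $[v,w]$. Let $1\le p<\infty$. A function $u:X_\varepsilon\to[-\infty,\infty]$ belongs to $\widetilde N^{1,p}(X_\varepsilon,\mu_\beta)$ if it is measurable, $\int|u|^p\,d\mu_\beta<\infty$, and it has a $p$-weak upper gradient $g\in L^p(X_\varepsilon,\mu_\beta)$ (that is, a measurable $g\ge 0$ with $|u(x)-u(y)|\le\int_\gamma g\,ds_\varepsilon$ for $p$-almost every nonconstant compact rectifiable curve $\gamma$ in $X_\varepsilon$, where $x,y$ are the endpoints of $\gamma$ and the left-hand side is read as $\infty$ if $u(x)$ or $u(y)$ is infinite). Let $g_u$ be its minimal $p$-weak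 upper gradient, so that $\|g_u\|_{L^p}$ is the least $L^p$ norm of a $p$-weak upper gradient of $u$, and let $\|u\|_{N^{1,p}}=\bigl(\int|u|^p\,d\mu_\beta+\inf_g\int g^p\,d\mu_\beta\bigr)^{1/p}$, the infimum being over all upper gradients $g$ of $u$. For $\theta>0$, $B^\theta_{p,p}(Z)$ is the space of all $f\in L^p(Z,\nu)$ with $$\|f\|_{\theta,p}^p=\int_Z\int_{Z\setminus\{\zeta\}}\frac{|f(\zeta)-f(\xi)|^p}{d_Z(\zeta,\xi)^{p\theta}}\,\frac{d\nu(\xi)\,d\nu(\zeta)}{\nu(B(\zeta,d_Z(\zeta,\xi)))}<\infty .$$ For $u:X_\varepsilon\to\mathbb R$, $\zeta\in Z$ and $n\ge0$ let $A_n(\zeta)=A_n\cap B(\zeta,\alpha^{-n})$ and $$u_n(\zeta)=\frac1{\#A_n(\zeta)}\sum_{z\in A_n(\zeta)}u((z,n)),\qquad \tilde u(\zeta)=\lim_{n\to\infty}u_n(\zeta).$$ **Theorem.** Let $0<\theta\le 1-\beta/(\varepsilon p)$. There is a constant $C$, independent of $u$, such that every $u\in\widetilde N^{1,p}(X_\varepsilon,\mu_\beta)$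 is real-valued, the limit defining $\tilde u(\zeta)$ exists for $\nu$-a.e. $\zeta\in Z$, $\tilde u\in B^\theta_{p,p}(Z)$, $$\|\tilde u\|_{\theta,p}\le C\|g_u\|_{L^p(X_\varepsilon,\mu_\beta)},$$ and $$\|\tilde u\|_{L^p(Z)}\le C\bigl(|u(v_0)|+\|g_u\|_{L^p(X_\varepsilon,\mu_\beta)}\bigr),\qquad |u(v_0)|+\|g_u\|_{L^p(X_\varepsilon,\mu_\beta)}\le C\|u\|_{N^{1,p}(X_\varepsilon,\mu_\beta)}.$$ If $u$ is a (real-valued) Lipschitz function on $X_\varepsilon$, then $u$ has a unique Lipschitz extension $\hat u$ to $\overline X_\varepsilon$, the limit defining $\tilde u(\zeta)$ exists for every $\zeta\in Z$, and $\tilde u=\hat u|_Z$, that is, $\tilde u(\zeta)=\hat u(\Psi(\zeta))$ for all $\zeta\in Z$. -/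

import Mathlib

open Set Filter Topology MeasureTheory
open scoped NNReal ENNReal unitInterval

/-! ### Rectifiable curves and curve integrals -/

section Curves

set_option linter.unusedSectionVars false

/-- Concatenation of two curves. -/
noncomputable def curveAppend {Y : Type*} (γ₁ γ₂ : ℝ → Y) (L₁ : ℝ) : ℝ → Y :=
  fun t => if t ≤ L₁ then γ₁ t else γ₂ (t - L₁)

theorem curveAppend_left {Y : Type*} {γ₁ γ₂ : ℝ → Y} {L₁ t : ℝ} (ht : t ≤ L₁) :
    curveAppend γ₁ γ₂ L₁ t = γ₁ t := by simp [curveAppend, ht]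

theorem curveAppend_right {Y : Type*} {γ₁ γ₂ : ℝ → Y} {L₁ t : ℝ} (h : γ₁ L₁ = γ₂ 0) (ht : L₁ ≤ t) :
    curveAppend γ₁ γ₂ L₁ t = γ₂ (t - L₁) := by
  rcases ht.eq_or_lt with rfl | ht
  · simp [curveAppend, h]
  · simp [curveAppend, not_le.2 ht]

variable {Y : Type*} [PseudoEMetricSpace Y]

/-- `γ`, restricted to `[0, L]`, is a curve parametrized by arc length (so `L` is its length).
Every nonconstant compact rectifiable curve has exactly one such parametrization, with `0 < L`. -/
def IsArcLengthCurve (γ : ℝ → Y) (L : ℝ) : Prop :=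
  0 ≤ L ∧ HasUnitSpeedOn γ (Icc 0 L)

/-- The curve integral `∫_γ g ds` of a curve parametrized by arc length. -/
noncomputable def arcIntegral (g : Y → ℝ≥0∞) (γ : ℝ → Y) (L : ℝ) : ℝ≥0∞ :=
  ∫⁻ t in Icc 0 L, g (γ t)

theorem IsArcLengthCurve.edist_le {γ : ℝ → Y} {L : ℝ} (h : IsArcLengthCurve γ L) {s t : ℝ}
    (hs : 0 ≤ s) (hst : s ≤ t) (ht : t ≤ L) :
    edist (γ s) (γ t) ≤ ENNReal.ofReal (t - s) := by
  have h1 := h.2 (x := s) ⟨hs, hst.trans ht⟩ (y := t) ⟨hs.trans hst, ht⟩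
  rw [NNReal.coe_one, one_mul] at h1
  rw [← h1]
  exact eVariationOn.edist_le γ ⟨⟨hs, hst.trans ht⟩, le_rfl, hst⟩ ⟨⟨hs.trans hst, ht⟩, hst, le_rfl⟩

theorem isArcLengthCurve_zero (x : Y) : IsArcLengthCurve (fun _ => x) 0 :=
  ⟨le_rfl, hasConstantSpeedOnWith_of_subsingleton _ (by simp) _⟩

theorem hasUnitSpeedOn_of_isometry {γ : ℝ → Y} {a b : ℝ}
    (h : ∀ s ∈ Icc a b, ∀ t ∈ Icc a b, edist (γ s) (γ t) = edist s t) :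
    HasUnitSpeedOn γ (Icc a b) := by
  rw [HasUnitSpeedOn, hasConstantSpeedOnWith_iff_ordered]
  intro x hx y hy hxy
  have hI : Icc a b ∩ Icc x y = Icc x y :=
    inter_eq_right.2 (Icc_subset_Icc hx.1 hy.2)
  rw [hI, NNReal.coe_one, one_mul]
  have hsub : Icc x y ⊆ Icc a b := Icc_subset_Icc hx.1 hy.2
  apply le_antisymm
  · have hl : LipschitzOnWith 1 γ (Icc x y) := fun s hs t ht => by
      rw [h s (hsub hs) t (hsub ht)]; simp
    have h1 := hl.comp_eVariationOn_le (g := id) (s := Icc x y) (fun z hz => hz)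
    have h2 : eVariationOn (id : ℝ → ℝ) (Icc x y ∩ Icc x y) = ENNReal.ofReal (id y - id x) :=
      (monotone_id.monotoneOn _).eVariationOn_eq (left_mem_Icc.2 hxy) (right_mem_Icc.2 hxy)
    rw [inter_self] at h2
    calc eVariationOn γ (Icc x y) ≤ ((1 : ℝ≥0) : ℝ≥0∞) * eVariationOn (id : ℝ → ℝ) (Icc x y) := h1
      _ ≤ ENNReal.ofReal (y - x) := by rw [ENNReal.coe_one, one_mul]; exact h2.le
  · have h1 := eVariationOn.edist_le γ (left_mem_Icc.2 hxy) (right_mem_Icc.2 hxy)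
    rwa [h x hx y hy, edist_dist, Real.dist_eq, abs_sub_comm, abs_of_nonneg (by linarith)] at h1

theorem HasUnitSpeedOn.comp_add {γ : ℝ → Y} {a b c : ℝ} (h : HasUnitSpeedOn γ (Icc a b)) :
    HasUnitSpeedOn (fun t => γ (t - c)) (Icc (a + c) (b + c)) := by
  rw [HasUnitSpeedOn, hasConstantSpeedOnWith_iff_ordered]
  intro x hx y hy hxy
  have h1 := h (x := x - c) ⟨by linarith [hx.1], by linarith [hx.2]⟩ (y := y - c)
    ⟨by linarith [hy.1], by linarith [hy.2]⟩
  have hm : Monotone (fun t : ℝ => t - c) := fun s t hst => sub_le_sub_right hst c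
  have h2 := eVariationOn.comp_eq_of_monotoneOn γ (t := Icc (a + c) (b + c) ∩ Icc x y)
    (fun t : ℝ => t - c) (hm.monotoneOn _)
  have h3 : (fun t : ℝ => t - c) '' (Icc (a + c) (b + c) ∩ Icc x y)
      = Icc a b ∩ Icc (x - c) (y - c) := by
    ext t
    simp only [mem_image, mem_inter_iff, mem_Icc]
    constructor
    · rintro ⟨s, hs, rfl⟩
      refine ⟨⟨?_, ?_⟩, ?_, ?_⟩ <;> linarith [hs.1.1, hs.1.2, hs.2.1, hs.2.2]
    · intro ht
      refine ⟨t + c, ⟨⟨?_, ?_⟩, ?_, ?_⟩, ?_⟩ <;> linarith [ht.1.1, ht.1.2, ht.2.1, ht.2.2]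
  rw [h3, h1] at h2
  rw [show (fun t => γ (t - c)) = γ ∘ (fun t : ℝ => t - c) from rfl, h2]
  congr 2
  ring

theorem IsArcLengthCurve.reverse {γ : ℝ → Y} {L : ℝ} (h : IsArcLengthCurve γ L) :
    IsArcLengthCurve (fun t => γ (L - t)) L := by
  refine ⟨h.1, ?_⟩
  rw [HasUnitSpeedOn, hasConstantSpeedOnWith_iff_ordered]
  intro x hx y hy hxy
  have h1 := h.2 (x := L - y) ⟨by linarith [hy.2], by linarith [hy.1]⟩ (y := L - x)
    ⟨by linarith [hx.2], by linarith [hx.1]⟩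
  have hm : Antitone (fun t : ℝ => L - t) := fun s t hst => sub_le_sub_left hst L
  have h2 := eVariationOn.comp_eq_of_antitoneOn γ (t := Icc 0 L ∩ Icc x y)
    (fun t : ℝ => L - t) (hm.antitoneOn _)
  have h3 : (fun t : ℝ => L - t) '' (Icc 0 L ∩ Icc x y) = Icc 0 L ∩ Icc (L - y) (L - x) := by
    ext t
    simp only [mem_image, mem_inter_iff, mem_Icc]
    constructor
    · rintro ⟨s, hs, rfl⟩
      refine ⟨⟨?_, ?_⟩, ?_, ?_⟩ <;> linarith [hs.1.1, hs.1.2, hs.2.1, hs.2.2]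
    · intro ht
      refine ⟨L - t, ⟨⟨?_, ?_⟩, ?_, ?_⟩, ?_⟩ <;> linarith [ht.1.1, ht.1.2, ht.2.1, ht.2.2]
  rw [h3, h1] at h2
  rw [show (fun t => γ (L - t)) = γ ∘ (fun t : ℝ => L - t) from rfl, h2]
  congr 2
  ring

theorem arcIntegral_reverse (g : Y → ℝ≥0∞) (γ : ℝ → Y) (L : ℝ) :
    arcIntegral g (fun t => γ (L - t)) L = arcIntegral g γ L := by
  unfold arcIntegral
  rw [← lintegral_indicator measurableSet_Icc, ← lintegral_indicator measurableSet_Icc,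
    ← lintegral_sub_left_eq_self (μ := volume) ((Icc 0 L).indicator fun t => g (γ t)) L]
  congr 1
  ext t
  by_cases ht : t ∈ Icc 0 L
  · rw [indicator_of_mem ht, indicator_of_mem (s := Icc 0 L)]
    exact ⟨by linarith [ht.2], by linarith [ht.1]⟩
  · rw [indicator_of_notMem ht, indicator_of_notMem (s := Icc 0 L)]
    exact fun h => ht ⟨by linarith [h.2], by linarith [h.1]⟩

theorem HasUnitSpeedOn.congr {γ γ' : ℝ → Y} {s : Set ℝ} (h : HasUnitSpeedOn γ s)
    (hE : EqOn γ' γ s) : HasUnitSpeedOn γ' s := fun x hx y hy => by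
  rw [← h hx hy]
  exact eVariationOn.eq_of_eqOn (hE.mono inter_subset_left)

theorem IsArcLengthCurve.append {γ₁ γ₂ : ℝ → Y} {L₁ L₂ : ℝ} (h₁ : IsArcLengthCurve γ₁ L₁)
    (h₂ : IsArcLengthCurve γ₂ L₂) (h : γ₁ L₁ = γ₂ 0) :
    IsArcLengthCurve (curveAppend γ₁ γ₂ L₁) (L₁ + L₂) := by
  refine ⟨add_nonneg h₁.1 h₂.1, HasUnitSpeedOn.Icc_Icc (y := L₁) ?_ ?_⟩
  · exact h₁.2.congr fun t ht => curveAppend_left ht.2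
  · have := h₂.2.comp_add (c := L₁)
    rw [zero_add, add_comm L₂ L₁] at this
    exact this.congr fun t ht => curveAppend_right h ht.1

theorem arcIntegral_append_le (g : Y → ℝ≥0∞) {γ₁ γ₂ : ℝ → Y} {L₁ L₂ : ℝ} (hL₁ : 0 ≤ L₁)
    (hL₂ : 0 ≤ L₂) (h : γ₁ L₁ = γ₂ 0) :
    arcIntegral g (curveAppend γ₁ γ₂ L₁) (L₁ + L₂) ≤
      arcIntegral g γ₁ L₁ + arcIntegral g γ₂ L₂ := by
  unfold arcIntegral
  rw [← Icc_union_Icc_eq_Icc hL₁ (by linarith : L₁ ≤ L₁ + L₂)]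
  refine (lintegral_union_le _ _ _).trans (add_le_add ?_ ?_)
  · exact (setLIntegral_congr_fun measurableSet_Icc fun t ht => by
      simp only [curveAppend_left ht.2]).le
  · rw [← lintegral_indicator measurableSet_Icc, ← lintegral_indicator measurableSet_Icc,
      ← lintegral_sub_right_eq_self (μ := volume) ((Icc 0 L₂).indicator fun t => g (γ₂ t)) L₁]
    refine lintegral_mono fun t => ?_
    by_cases ht : t ∈ Icc L₁ (L₁ + L₂)
    · rw [indicator_of_mem ht, indicator_of_mem (s := Icc 0 L₂), curveAppend_right h ht.1]
      exact ⟨by linarith [ht.1], by linarith [ht.2]⟩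
    · rw [indicator_of_notMem ht]
      exact zero_le

end Curves

/-! ### Uniformization of a metric space -/

section Uniformization

variable {X : Type*} [MetricSpace X]

/-- The conformal density `ρ_ε(x) = exp(-ε d(x, x₀))`. -/
noncomputable def uniformizingDensity (ε : ℝ) (x₀ : X) (x : X) : ℝ≥0∞ :=
  ENNReal.ofReal (Real.exp (-ε * dist x x₀))

/-- The uniformized distance `d_ε(x, y) = inf_γ ∫_γ ρ_ε ds`, the infimum being taken over all
rectifiable curves `γ` from `x` to `y`. -/
noncomputable def uniformizedEDist (ε : ℝ) (x₀ x y : X) : ℝ≥0∞ :=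
  ⨅ (γ : ℝ → X) (L : ℝ) (_ : IsArcLengthCurve γ L) (_ : γ 0 = x) (_ : γ L = y),
    arcIntegral (uniformizingDensity ε x₀) γ L

theorem uniformizedEDist_le {ε : ℝ} {x₀ x y : X} {γ : ℝ → X} {L : ℝ} (h : IsArcLengthCurve γ L)
    (hx : γ 0 = x) (hy : γ L = y) :
    uniformizedEDist ε x₀ x y ≤ arcIntegral (uniformizingDensity ε x₀) γ L :=
  iInf_le_of_le γ <| iInf_le_of_le L <| iInf_le_of_le h <| iInf_le_of_le hx <|
    iInf_le_of_le hy le_rfl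

theorem uniformizedEDist_self (ε : ℝ) (x₀ x : X) : uniformizedEDist ε x₀ x x = 0 := by
  have h := uniformizedEDist_le (ε := ε) (x₀ := x₀) (isArcLengthCurve_zero x) rfl rfl
  have h0 : arcIntegral (uniformizingDensity ε x₀) (fun _ => x) 0 = 0 := by
    simp [arcIntegral]
  exact le_antisymm (h.trans h0.le) zero_le

theorem uniformizedEDist_comm_le (ε : ℝ) (x₀ x y : X) :
    uniformizedEDist ε x₀ x y ≤ uniformizedEDist ε x₀ y x := by
  refine le_iInf fun γ => le_iInf fun L => le_iInf fun h => le_iInf fun hx => le_iInf fun hy => ?_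
  rw [← arcIntegral_reverse]
  exact uniformizedEDist_le h.reverse (by simpa using hy) (by simpa using hx)

theorem uniformizedEDist_triangle (ε : ℝ) (x₀ x y z : X) :
    uniformizedEDist ε x₀ x z ≤ uniformizedEDist ε x₀ x y + uniformizedEDist ε x₀ y z := by
  rw [uniformizedEDist.eq_1 ε x₀ y z]
  simp only [ENNReal.add_iInf]
  refine le_iInf fun γ₂ => le_iInf fun L₂ => le_iInf fun h₂ => le_iInf fun hx₂ =>
    le_iInf fun hy₂ => ?_
  rw [uniformizedEDist.eq_1 ε x₀ x y]
  simp only [ENNReal.iInf_add]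
  refine le_iInf fun γ₁ => le_iInf fun L₁ => le_iInf fun h₁ => le_iInf fun hx₁ =>
    le_iInf fun hy₁ => ?_
  refine (uniformizedEDist_le (h₁.append h₂ (hy₁.trans hx₂.symm)) ?_ ?_).trans
    (arcIntegral_append_le _ h₁.1 h₂.1 (hy₁.trans hx₂.symm))
  · rw [curveAppend_left h₁.1, hx₁]
  · rw [curveAppend_right (hy₁.trans hx₂.symm) (by linarith [h₂.1]), add_sub_cancel_left, hy₂]

theorem IsArcLengthCurve.dist_le {γ : ℝ → X} {L : ℝ} (h : IsArcLengthCurve γ L) {t : ℝ}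
    (ht : 0 ≤ t) (htL : t ≤ L) : dist (γ 0) (γ t) ≤ t := by
  have h1 := h.edist_le le_rfl ht htL
  rw [sub_zero, edist_dist] at h1
  exact (ENNReal.ofReal_le_ofReal_iff ht).1 h1

theorem uniformizedEDist_lower (ε : ℝ) (x₀ x y : X) :
    ENNReal.ofReal (Real.exp (-|ε| * (dist x x₀ + 1))) * ENNReal.ofReal (min (dist x y) 1) ≤
      uniformizedEDist ε x₀ x y := by
  refine le_iInf fun γ => le_iInf fun L => le_iInf fun h => le_iInf fun hx => le_iInf fun hy => ?_
  set m := min (dist x y) 1 with hm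
  have hmL : m ≤ L := (min_le_left _ _).trans (by
    have := h.dist_le h.1 le_rfl
    rwa [hx, hy] at this)
  have hsub : Icc (0 : ℝ) m ⊆ Icc 0 L := Icc_subset_Icc_right hmL
  calc ENNReal.ofReal (Real.exp (-|ε| * (dist x x₀ + 1))) * ENNReal.ofReal m
      = ∫⁻ _ in Icc (0 : ℝ) m, ENNReal.ofReal (Real.exp (-|ε| * (dist x x₀ + 1))) := by
        rw [setLIntegral_const, Real.volume_Icc, sub_zero]
    _ ≤ ∫⁻ t in Icc (0 : ℝ) m, uniformizingDensity ε x₀ (γ t) := by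
        refine setLIntegral_mono' measurableSet_Icc fun t ht => ?_
        refine ENNReal.ofReal_le_ofReal (Real.exp_le_exp.2 ?_)
        have h1 := h.dist_le ht.1 (hsub ht).2
        have h2 : dist (γ t) x₀ ≤ dist x x₀ + 1 := by
          have h3 := dist_triangle_left (γ t) x₀ (γ 0)
          have h4 : t ≤ 1 := ht.2.trans (min_le_right _ _)
          rw [hx] at h1 h3
          linarith
        have h5 : ε * dist (γ t) x₀ ≤ |ε| * (dist x x₀ + 1) :=
          (mul_le_mul_of_nonneg_right (le_abs_self ε) dist_nonneg).trans
            (mul_le_mul_of_nonneg_left h2 (abs_nonneg ε))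
        linarith
    _ ≤ arcIntegral (uniformizingDensity ε x₀) γ L := lintegral_mono_set hsub

theorem eq_of_uniformizedEDist_eq_zero {ε : ℝ} {x₀ x y : X} (h : uniformizedEDist ε x₀ x y = 0) :
    x = y := by
  have h1 := uniformizedEDist_lower ε x₀ x y
  rw [h, nonpos_iff_eq_zero, mul_eq_zero, ENNReal.ofReal_eq_zero, ENNReal.ofReal_eq_zero] at h1
  rcases h1 with h1 | h1
  · exact absurd h1 (not_le.2 (Real.exp_pos _))
  · rcases min_le_iff.1 h1 with h1 | h1
    · exact dist_le_zero.1 h1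
    · exact absurd h1 (by norm_num)

theorem uniformizedEDist_ne_top (ε : ℝ) (x₀ : X) {γ : ℝ → X} {L : ℝ} (h : IsArcLengthCurve γ L) :
    uniformizedEDist ε x₀ (γ 0) (γ L) ≠ ⊤ := by
  refine ne_top_of_le_ne_top ?_ (uniformizedEDist_le h rfl rfl)
  have h1 : arcIntegral (uniformizingDensity ε x₀) γ L ≤
      ∫⁻ _ in Icc (0 : ℝ) L, ENNReal.ofReal (Real.exp (|ε| * (dist (γ 0) x₀ + L))) := by
    refine setLIntegral_mono' measurableSet_Icc fun t ht => ?_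
    refine ENNReal.ofReal_le_ofReal (Real.exp_le_exp.2 ?_)
    have h1 := h.dist_le ht.1 ht.2
    have h2 : dist (γ t) x₀ ≤ dist (γ 0) x₀ + L := by
      have h3 := dist_triangle_left (γ t) x₀ (γ 0)
      linarith [ht.2]
    exact (mul_le_mul_of_nonneg_right (neg_le_abs ε) dist_nonneg).trans
        (mul_le_mul_of_nonneg_left h2 (abs_nonneg ε))
  refine ne_top_of_le_ne_top ?_ h1
  rw [setLIntegral_const, Real.volume_Icc]
  exact ENNReal.mul_ne_top ENNReal.ofReal_ne_top ENNReal.ofReal_ne_top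

theorem uniformizedEDist_le_length {ε : ℝ} (hε : 0 ≤ ε) (x₀ : X) {γ : ℝ → X} {L : ℝ}
    (h : IsArcLengthCurve γ L) :
    uniformizedEDist ε x₀ (γ 0) (γ L) ≤ ENNReal.ofReal L := by
  refine (uniformizedEDist_le h rfl rfl).trans ?_
  have h1 : arcIntegral (uniformizingDensity ε x₀) γ L ≤ ∫⁻ _ in Icc (0 : ℝ) L, 1 := by
    refine setLIntegral_mono' measurableSet_Icc fun t _ => ?_
    rw [uniformizingDensity, ← ENNReal.ofReal_one]
    refine ENNReal.ofReal_le_ofReal (Real.exp_le_one_iff.2 ?_)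
    rw [neg_mul, neg_nonpos]
    exact mul_nonneg hε dist_nonneg
  simpa using h1

end Uniformization

/-! ### Metric graphs -/

section MetricGraph

variable {V : Type*}

open Classical in
/-- Barycentric coordinates of the point at parameter `t` on the edge from `v` to `w`. -/
noncomputable def edgeCoord (v w : V) (t : I) : V → ℝ :=
  fun u => (if u = v then 1 - (t : ℝ) else 0) + (if u = w then (t : ℝ) else 0)

/-- The geometric realization of a graph (every edge is replaced by a copy of `[0, 1]`), its points
being given by barycentric coordinates; a vertex `v` is the point with `v`-th coordinate `1`. -/
structure GraphRealization (G : SimpleGraph V) where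
  coord : V → ℝ
  exists_edge : ∃ v w : V, (v = w ∨ G.Adj v w) ∧ ∃ t : I, coord = edgeCoord v w t

namespace GraphRealization

variable {G : SimpleGraph V}

theorem ext_coord {x y : GraphRealization G} (h : x.coord = y.coord) : x = y := by
  cases x; cases y; cases h; rfl

/-- The vertex `v` as a point of the realization. -/
noncomputable def vertexPt (G : SimpleGraph V) (v : V) : GraphRealization G :=
  ⟨edgeCoord v v 0, v, v, Or.inl rfl, 0, rfl⟩

/-- The point at parameter `t ∈ [0, 1]` on the edge `[v, w]`. -/
noncomputable def edgePt {v w : V} (h : G.Adj v w) (t : I) : GraphRealization G :=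
  ⟨edgeCoord v w t, v, w, Or.inr h, t, rfl⟩

theorem edgePt_zero {v w : V} (h : G.Adj v w) : edgePt h 0 = vertexPt G v :=
  ext_coord (by ext u; simp [edgePt, vertexPt, edgeCoord])

theorem edgePt_one {v w : V} (h : G.Adj v w) : edgePt h 1 = vertexPt G w :=
  ext_coord (by ext u; simp [edgePt, vertexPt, edgeCoord])

theorem eq_vertexPt_or_edgePt (x : GraphRealization G) :
    (∃ v, x = vertexPt G v) ∨ ∃ (v w : V) (h : G.Adj v w) (t : I), x = edgePt h t := by
  obtain ⟨v, w, h | h, t, ht⟩ := x.exists_edge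
  · subst h
    exact Or.inl ⟨v, ext_coord (by rw [ht]; ext u; simp only [vertexPt, edgeCoord]; split_ifs <;> simp)⟩
  · exact Or.inr ⟨v, w, h, t, ext_coord ht⟩

/-- `PLPath x y ℓ`: there is a piecewise linear curve of length `ℓ` from `x` to `y`, that is, a
finite chain of segments, each contained in an edge (identified with `[0, 1]`). -/
inductive PLPath (G : SimpleGraph V) : GraphRealization G → GraphRealization G → ℝ≥0 → Prop
  | nil (x : GraphRealization G) : PLPath G x x 0
  | cons {v w : V} (h : G.Adj v w) (s t : I) (x y z : GraphRealization G) (ℓ : ℝ≥0)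
      (hx : x = edgePt h s) (hy : y = edgePt h t) (hp : PLPath G y z ℓ) :
      PLPath G x z (nndist s t + ℓ)

theorem PLPath.trans {x y z : GraphRealization G} {a b : ℝ≥0} (h₁ : PLPath G x y a)
    (h₂ : PLPath G y z b) : PLPath G x z (a + b) := by
  induction h₁ with
  | nil x => simpa using h₂
  | cons h s t x y z' ℓ hx hy _ ih =>
    rw [add_assoc]
    exact PLPath.cons h s t x y z _ hx hy (ih h₂)

theorem PLPath.single {v w : V} (h : G.Adj v w) (s t : I) :
    PLPath G (edgePt h s) (edgePt h t) (nndist s t) := by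
  simpa using PLPath.cons h s t _ _ _ 0 rfl rfl (PLPath.nil (edgePt h t))

theorem PLPath.symm {x y : GraphRealization G} {a : ℝ≥0} (h : PLPath G x y a) :
    PLPath G y x a := by
  induction h with
  | nil x => exact PLPath.nil x
  | cons h s t x y z ℓ hx hy _ ih =>
    subst hx hy
    rw [add_comm, nndist_comm]
    exact ih.trans (PLPath.single h t s)

theorem abs_edgeCoord_sub_le {v w : V} (h : v ≠ w) (s t : I) (u : V) :
    |edgeCoord v w s u - edgeCoord v w t u| ≤ dist s t := by
  have h0 : dist s t = |(s : ℝ) - t| := rfl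
  rw [h0]
  unfold edgeCoord
  split_ifs with h1 h2 h2
  · exact absurd (h1.symm.trans h2) h
  · rw [abs_sub_comm]; exact le_of_eq (by congr 1; ring)
  · exact le_of_eq (by congr 1; ring)
  · simp

theorem PLPath.abs_coord_sub_le {x y : GraphRealization G} {a : ℝ≥0} (h : PLPath G x y a)
    (u : V) : |x.coord u - y.coord u| ≤ a := by
  induction h with
  | nil x => simp
  | @cons v w h s t x y z ℓ hx hy _ ih =>
    subst hx hy
    have h1 := abs_edgeCoord_sub_le h.ne s t u
    have h2 := abs_sub_le (edgeCoord v w s u) (edgeCoord v w t u) (z.coord u)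
    rw [NNReal.coe_add, coe_nndist]
    exact h2.trans (add_le_add h1 ih)

/-- The length distance of the metric graph in which every edge has length `1` (it is infinite
between different components). -/
noncomputable instance : EMetricSpace (GraphRealization G) where
  edist x y := ⨅ (ℓ : ℝ≥0) (_ : PLPath G x y ℓ), (ℓ : ℝ≥0∞)
  edist_self x := le_antisymm (iInf₂_le_of_le 0 (PLPath.nil x) (by simp)) zero_le
  edist_comm x y := by
    refine le_antisymm ?_ ?_ <;>
    exact le_iInf₂ fun ℓ h => iInf₂_le_of_le ℓ h.symm le_rfl
  edist_triangle x y z := by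
    simp only [ENNReal.add_iInf]
    refine le_iInf fun b => le_iInf fun hb => ?_
    simp only [ENNReal.iInf_add]
    refine le_iInf fun a => le_iInf fun ha => ?_
    exact iInf₂_le_of_le (a + b) (ha.trans hb) (by simp)
  eq_of_edist_eq_zero {x y} h := by
    refine ext_coord (funext fun u => ?_)
    by_contra hne
    have hpos : 0 < |x.coord u - y.coord u| := abs_pos.2 (sub_ne_zero.2 hne)
    have h1 : ENNReal.ofReal |x.coord u - y.coord u| ≤
        ⨅ (ℓ : ℝ≥0) (_ : PLPath G x y ℓ), (ℓ : ℝ≥0∞) :=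
      le_iInf₂ fun ℓ hl => ENNReal.ofReal_le_of_le_toReal (by simpa using hl.abs_coord_sub_le u)
    rw [h, nonpos_iff_eq_zero, ENNReal.ofReal_eq_zero] at h1
    exact absurd h1 (not_le.2 hpos)

theorem edist_def (x y : GraphRealization G) :
    edist x y = ⨅ (ℓ : ℝ≥0) (_ : PLPath G x y ℓ), (ℓ : ℝ≥0∞) := rfl

theorem PLPath.edist_le {x y : GraphRealization G} {a : ℝ≥0} (h : PLPath G x y a) :
    edist x y ≤ a := iInf₂_le_of_le a h le_rfl

theorem edist_edgePt {v w : V} (h : G.Adj v w) (s t : I) :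
    edist (edgePt h s) (edgePt h t) = edist s t := by
  refine le_antisymm ?_ ?_
  · rw [edist_nndist s t]; exact (PLPath.single h s t).edist_le
  · refine le_iInf₂ fun ℓ hl => ?_
    have h1 := hl.abs_coord_sub_le w
    have h2 : (edgePt h s).coord w - (edgePt h t).coord w = (s : ℝ) - t := by
      simp [edgePt, edgeCoord, h.ne']
    rw [h2] at h1
    rw [edist_nndist]
    exact_mod_cast h1

theorem PLPath.of_reachable {v w : V} (h : G.Reachable v w) :
    ∃ a, PLPath G (vertexPt G v) (vertexPt G w) a := by
  obtain ⟨p⟩ := h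
  induction p with
  | nil => exact ⟨0, PLPath.nil _⟩
  | cons h _ ih =>
    obtain ⟨a, ha⟩ := ih
    exact ⟨_, PLPath.cons h 0 1 _ _ _ a (edgePt_zero h).symm (edgePt_one h).symm ha⟩

theorem PLPath.of_connected (hG : ∀ v w, G.Reachable v w) (x y : GraphRealization G) :
    ∃ a, PLPath G x y a := by
  have key : ∀ x : GraphRealization G, ∃ v a, PLPath G x (vertexPt G v) a := by
    intro x
    rcases x.eq_vertexPt_or_edgePt with ⟨v, rfl⟩ | ⟨v, w, h, t, rfl⟩
    · exact ⟨v, 0, PLPath.nil _⟩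
    · exact ⟨v, _, by simpa [edgePt_zero] using PLPath.single h t 0⟩
  obtain ⟨v, a, ha⟩ := key x
  obtain ⟨w, b, hb⟩ := key y
  obtain ⟨c, hc⟩ := PLPath.of_reachable (hG v w)
  exact ⟨_, (ha.trans hc).trans hb.symm⟩

theorem exists_arc_edgePt {v w : V} (h : G.Adj v w) (s t : I) :
    ∃ γ : ℝ → GraphRealization G, IsArcLengthCurve γ (dist s t) ∧ γ 0 = edgePt h s ∧
      γ (dist s t) = edgePt h t := by
  have key : ∀ s t : I, s ≤ t → ∃ γ : ℝ → GraphRealization G,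
      IsArcLengthCurve γ (dist s t) ∧ γ 0 = edgePt h s ∧ γ (dist s t) = edgePt h t := by
    intro s t hst
    have hst' : (s : ℝ) ≤ t := hst
    have hd : dist s t = (t : ℝ) - s := by
      rw [Subtype.dist_eq, Real.dist_eq, abs_sub_comm, abs_of_nonneg (by linarith)]
    refine ⟨fun r => edgePt h (projIcc 0 1 zero_le_one (s + r)), ⟨dist_nonneg, ?_⟩, ?_, ?_⟩
    · refine hasUnitSpeedOn_of_isometry fun a ha b hb => ?_
      have hm : ∀ c ∈ Icc 0 (dist s t), (s : ℝ) + c ∈ Icc (0 : ℝ) 1 := fun c hc => by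
        rw [hd] at hc
        exact ⟨by linarith [s.2.1, hc.1], by linarith [t.2.2, hc.2]⟩
      simp only [edist_edgePt]
      rw [projIcc_of_mem _ (hm a ha), projIcc_of_mem _ (hm b hb), Subtype.edist_eq]
      simp [edist_dist]
    · simp
    · simp [hd]
  rcases le_total s t with hst | hst
  · exact key s t hst
  · obtain ⟨γ, h1, h2, h3⟩ := key t s hst
    rw [dist_comm]
    exact ⟨_, h1.reverse, by simpa using h3, by simpa using h2⟩

theorem PLPath.exists_arc {x y : GraphRealization G} {a : ℝ≥0} (h : PLPath G x y a) :
    ∃ γ : ℝ → GraphRealization G, IsArcLengthCurve γ a ∧ γ 0 = x ∧ γ a = y := by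
  induction h with
  | nil x => exact ⟨_, isArcLengthCurve_zero x, rfl, rfl⟩
  | cons h s t x y z ℓ hx hy _ ih =>
    obtain ⟨γ₂, h₂, h₂x, h₂z⟩ := ih
    obtain ⟨γ₁, h₁, h₁x, h₁y⟩ := exists_arc_edgePt h s t
    have hj : γ₁ (dist s t) = γ₂ 0 := by rw [h₁y, h₂x, hy]
    refine ⟨curveAppend γ₁ γ₂ (dist s t), ?_, ?_, ?_⟩
    · rw [NNReal.coe_add, coe_nndist]; exact h₁.append h₂ hj
    · rw [curveAppend_left dist_nonneg, h₁x, hx]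
    · rw [NNReal.coe_add, coe_nndist,
        curveAppend_right hj (le_add_of_nonneg_right ℓ.coe_nonneg), add_sub_cancel_left, h₂z]

end GraphRealization

end MetricGraph

/-! ### Hyperbolic fillings -/

/-- The data from which a hyperbolic filling of `Z` with parameters `α, τ > 1` is built: an
increasing sequence of maximal `α⁻ⁿ`-separated sets `A n`, with `A 0 = {z₀}`. -/
structure HyperbolicFilling (Z : Type*) [MetricSpace Z] (α τ : ℝ) where
  one_lt_alpha : 1 < α
  one_lt_tau : 1 < τ
  z₀ : Z
  A : ℕ → Set Z
  A_zero : A 0 = {z₀}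
  A_mono : Monotone A
  A_maximal : ∀ n, Maximal (fun B : Set Z => B.Pairwise fun x y => (α ^ n)⁻¹ ≤ dist x y) (A n)

namespace HyperbolicFilling

variable {Z : Type*} [MetricSpace Z] {α τ : ℝ} (F : HyperbolicFilling Z α τ)

theorem exists_mem_dist_lt (n : ℕ) (z : Z) : ∃ x ∈ F.A n, dist x z < (α ^ n)⁻¹ := by
  by_contra! hcon
  have hpos : 0 < (α ^ n)⁻¹ := inv_pos.2 (pow_pos (one_pos.trans F.one_lt_alpha) n)
  have h1 : z ∈ F.A n := by
    refine (F.A_maximal n).2 (y := insert z (F.A n)) ?_ (subset_insert _ _) (mem_insert _ _)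
    refine (F.A_maximal n).1.insert fun x hx _ => ⟨?_, hcon x hx⟩
    rw [dist_comm]; exact hcon x hx
  have := hcon z h1
  rw [dist_self] at this
  exact absurd this (not_le.2 hpos)

/-- The vertices `(z, n)`, `z ∈ A n`. -/
def Vertex : Type _ := {v : Z × ℕ // v.1 ∈ F.A v.2}

/-- The neighbor relation of the hyperbolic filling. -/
def graph : SimpleGraph F.Vertex where
  Adj v w := v ≠ w ∧
    ((v.1.2 = w.1.2 ∧ (Metric.ball v.1.1 (τ * (α ^ v.1.2)⁻¹) ∩
        Metric.ball w.1.1 (τ * (α ^ w.1.2)⁻¹)).Nonempty) ∨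
      ((v.1.2 = w.1.2 + 1 ∨ w.1.2 = v.1.2 + 1) ∧
        (Metric.ball v.1.1 (α ^ v.1.2)⁻¹ ∩ Metric.ball w.1.1 (α ^ w.1.2)⁻¹).Nonempty))
  symm := ⟨by
    rintro v w ⟨hne, ⟨h1, h2⟩ | ⟨h1, h2⟩⟩
    · exact ⟨hne.symm, Or.inl ⟨h1.symm, by rwa [inter_comm]⟩⟩
    · exact ⟨hne.symm, Or.inr ⟨h1.symm, by rwa [inter_comm]⟩⟩⟩
  loopless := ⟨fun v h => h.1 rfl⟩

/-- The root `v₀ = (z₀, 0)`. -/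
def root : F.Vertex := ⟨(F.z₀, 0), by rw [F.A_zero]; exact mem_singleton _⟩

theorem reachable_root (v : F.Vertex) : F.graph.Reachable v F.root := by
  obtain ⟨⟨z, n⟩, hz⟩ := v
  induction n generalizing z with
  | zero =>
    have : z = F.z₀ := by simpa [F.A_zero] using hz
    subst this
    exact SimpleGraph.Reachable.refl _
  | succ n ih =>
    obtain ⟨x, hx, hxz⟩ := F.exists_mem_dist_lt n z
    have hpos : 0 < (α ^ (n + 1))⁻¹ :=
      inv_pos.2 (pow_pos (one_pos.trans F.one_lt_alpha) _)
    have hadj : F.graph.Adj ⟨(z, n + 1), hz⟩ ⟨(x, n), hx⟩ := by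
      refine ⟨fun h => ?_, Or.inr ⟨Or.inl rfl, z, Metric.mem_ball_self hpos, ?_⟩⟩
      · have := congrArg (fun v : F.Vertex => v.1.2) h
        simp at this
      · rw [Metric.mem_ball, dist_comm]; exact hxz
    exact hadj.reachable.trans (ih x hx)

/-- The hyperbolic filling `X`, as a metric graph with edges of unit length. -/
def Space : Type _ := GraphRealization F.graph

noncomputable instance : MetricSpace F.Space :=
  letI : EMetricSpace F.Space := inferInstanceAs (EMetricSpace (GraphRealization F.graph))
  EMetricSpace.toMetricSpace fun x y => by
    obtain ⟨a, ha⟩ := GraphRealization.PLPath.of_connected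
      (fun v w => (F.reachable_root v).trans (F.reachable_root w).symm) x y
    exact ne_top_of_le_ne_top ENNReal.coe_ne_top ha.edist_le

theorem exists_arc (x y : F.Space) :
    ∃ (γ : ℝ → F.Space) (L : ℝ), IsArcLengthCurve γ L ∧ γ 0 = x ∧ γ L = y := by
  obtain ⟨a, ha⟩ := GraphRealization.PLPath.of_connected
    (fun v w => (F.reachable_root v).trans (F.reachable_root w).symm) x y
  obtain ⟨γ, h1, h2, h3⟩ := ha.exists_arc
  exact ⟨γ, a, h1, h2, h3⟩

/-- The root as a point of `X`. -/
noncomputable def rootPt : F.Space := GraphRealization.vertexPt F.graph F.root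

/-- The underlying set of the uniformization `X_ε`; it carries the metric `d_ε`. -/
def Unif (_ε : ℝ) : Type _ := F.Space

/-- The extended metric underlying `d_ε`. -/
noncomputable abbrev unifEMetricSpace (ε : ℝ) : EMetricSpace (F.Unif ε) where
  edist := uniformizedEDist (X := F.Space) ε F.rootPt
  edist_self := uniformizedEDist_self (X := F.Space) ε F.rootPt
  edist_comm x y := le_antisymm (uniformizedEDist_comm_le (X := F.Space) ε F.rootPt x y)
    (uniformizedEDist_comm_le (X := F.Space) ε F.rootPt y x)
  edist_triangle := uniformizedEDist_triangle (X := F.Space) ε F.rootPt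
  eq_of_edist_eq_zero := eq_of_uniformizedEDist_eq_zero (X := F.Space)

/-- The uniformized metric `d_ε` centered at the root. -/
noncomputable instance (ε : ℝ) : MetricSpace (F.Unif ε) :=
  letI : EMetricSpace (F.Unif ε) := F.unifEMetricSpace ε
  EMetricSpace.toMetricSpace fun x y => by
    obtain ⟨γ, L, h, rfl, rfl⟩ := F.exists_arc x y
    exact uniformizedEDist_ne_top ε F.rootPt h

noncomputable instance (ε : ℝ) : MeasurableSpace (F.Unif ε) := borel _

instance (ε : ℝ) : BorelSpace (F.Unif ε) := ⟨rfl⟩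

/-- The vertex `v` as a point of `X_ε`. -/
noncomputable def vertexPt (ε : ℝ) (v : F.Vertex) : F.Unif ε :=
  GraphRealization.vertexPt F.graph v

/-- The point at parameter `t ∈ [0, 1]` on the edge `[v, w]`, as a point of `X_ε`. -/
noncomputable def edgePt (ε : ℝ) {v w : F.Vertex} (h : F.graph.Adj v w) (t : I) : F.Unif ε :=
  GraphRealization.edgePt h t

theorem continuous_edgePt {ε : ℝ} (hε : 0 ≤ ε) {v w : F.Vertex} (h : F.graph.Adj v w) :
    Continuous (F.edgePt ε h) := by
  refine LipschitzWith.continuous (K := 1) fun s t => ?_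
  obtain ⟨γ, h1, h2, h3⟩ := GraphRealization.exists_arc_edgePt h s t
  have := uniformizedEDist_le_length (X := F.Space) hε F.rootPt h1
  rw [h2, h3, ← edist_dist] at this
  rw [ENNReal.coe_one, one_mul]
  exact this

section Measure

variable [MeasurableSpace Z]

/-- The weight `e^{-β n} ν(B(z, α⁻ⁿ))` of the vertex `(z, n)`. -/
noncomputable def vertexWeight (β : ℝ) (ν : Measure Z) (v : F.Vertex) : ℝ≥0∞ :=
  ENNReal.ofReal (Real.exp (-β * v.1.2)) * ν (Metric.ball v.1.1 (α ^ v.1.2)⁻¹)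

/-- The measure `μ_β` on `X_ε`: the vertex weights are smeared out over the edges, on each of which
the measure is a multiple of the Lebesgue measure of the unit interval. -/
noncomputable def mu (ε β : ℝ) (ν : Measure Z) : Measure (F.Unif ε) :=
  Measure.sum fun v : F.Vertex => Measure.sum fun w : {w : F.Vertex // F.graph.Adj v w} =>
    (F.vertexWeight β ν v + F.vertexWeight β ν w.1) •
      Measure.map (F.edgePt ε w.2) (volume : Measure I)

end Measure

/-- `A_n(ζ) = A_n ∩ B(ζ, α⁻ⁿ)`. -/
def near (n : ℕ) (ζ : Z) : Set Z := F.A n ∩ Metric.ball ζ (α ^ n)⁻¹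

/-- `u_n(ζ)`: the average of `u` over the vertices `(z, n)` with `z ∈ A_n(ζ)`. -/
noncomputable def avg (ε : ℝ) (u : F.Unif ε → ℝ) (n : ℕ) (ζ : Z) : ℝ :=
  (∑ᶠ z : F.near n ζ, u (F.vertexPt ε ⟨(z.1, n), z.2.1⟩)) / (F.near n ζ).ncard

/-- The trace `ũ(ζ) = lim u_n(ζ)` (a junk value where the limit does not exist). -/
noncomputable def trace (ε : ℝ) (u : F.Unif ε → ℝ) (ζ : Z) : ℝ :=
  limUnder atTop fun n => F.avg ε u n ζ

/-- For each `n`, a choice of a vertex `(z, n)` with `z ∈ A_n(ζ)`. -/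
noncomputable def approxVertex (ζ : Z) (n : ℕ) : F.Vertex :=
  ⟨((F.exists_mem_dist_lt n ζ).choose, n), (F.exists_mem_dist_lt n ζ).choose_spec.1⟩

/-- The natural identification `Ψ` of `Z` with the boundary of `X_ε` in its completion:
`Ψ(ζ)` is the limit of vertices `(z_n, n)` with `z_n ∈ A_n`, `d(z_n, ζ) < α⁻ⁿ`. -/
noncomputable def boundaryMap (ε : ℝ) (ζ : Z) : UniformSpace.Completion (F.Unif ε) :=
  haveI : Nonempty (UniformSpace.Completion (F.Unif ε)) := ⟨(F.vertexPt ε F.root : F.Unif ε)⟩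
  limUnder atTop fun n => (F.vertexPt ε (F.approxVertex ζ n) : UniformSpace.Completion (F.Unif ε))

end HyperbolicFilling

/-! ### Newtonian and Besov spaces -/

section FunctionSpaces

variable {Y : Type*} [MetricSpace Y] [MeasurableSpace Y]

/-- `|a - b|` for extended real numbers, with value `∞` if one of them is infinite. -/
noncomputable def erealGap (a b : EReal) : ℝ≥0∞ :=
  if a = ⊥ ∨ a = ⊤ ∨ b = ⊥ ∨ b = ⊤ then ⊤ else ENNReal.ofReal |a.toReal - b.toReal|

/-- `g` is an upper gradient of `u`. -/
def IsUpperGradient (u : Y → EReal) (g : Y → ℝ≥0∞) : Prop :=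
  Measurable g ∧ ∀ (γ : ℝ → Y) (L : ℝ), 0 < L → IsArcLengthCurve γ L →
    erealGap (u (γ 0)) (u (γ L)) ≤ arcIntegral g γ L

/-- The property `P` holds for `p`-almost every (nonconstant compact rectifiable) curve: the
curves for which it fails form a family of zero `p`-modulus. -/
def ForAlmostEveryCurve (p : ℝ) (μ : Measure Y) (P : (ℝ → Y) → ℝ → Prop) : Prop :=
  ∃ ρ : Y → ℝ≥0∞, Measurable ρ ∧ ∫⁻ x, ρ x ^ p ∂μ < ⊤ ∧
    ∀ (γ : ℝ → Y) (L : ℝ), 0 < L → IsArcLengthCurve γ L → ¬ P γ L → arcIntegral ρ γ L = ⊤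

/-- `g` is a `p`-weak upper gradient of `u`. -/
def IsWeakUpperGradient (p : ℝ) (μ : Measure Y) (u : Y → EReal) (g : Y → ℝ≥0∞) : Prop :=
  AEMeasurable g μ ∧ ForAlmostEveryCurve p μ fun γ L =>
    erealGap (u (γ 0)) (u (γ L)) ≤ arcIntegral g γ L

/-- The `L^p` norm of a nonnegative function. -/
noncomputable def gradientLpNorm (p : ℝ) (μ : Measure Y) (g : Y → ℝ≥0∞) : ℝ≥0∞ :=
  (∫⁻ x, g x ^ p ∂μ) ^ (1 / p)

/-- `g` is a minimal `p`-weak upper gradient of `u`. -/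
def IsMinimalWeakUpperGradient (p : ℝ) (μ : Measure Y) (u : Y → EReal) (g : Y → ℝ≥0∞) : Prop :=
  IsWeakUpperGradient p μ u g ∧ gradientLpNorm p μ g < ⊤ ∧
    ∀ g', IsWeakUpperGradient p μ u g' → gradientLpNorm p μ g' < ⊤ → g ≤ᵐ[μ] g'

/-- The `L^p` norm of the minimal `p`-weak upper gradient `g_u` of `u`. Since `g_u` is itself a
`p`-weak upper gradient and lies below all others almost everywhere, this is the least `L^p` norm
of a `p`-weak upper gradient. -/
noncomputable def minimalGradientNorm (p : ℝ) (μ : Measure Y) (u : Y → EReal) : ℝ≥0∞ :=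
  ⨅ (g : Y → ℝ≥0∞) (_ : IsWeakUpperGradient p μ u g), gradientLpNorm p μ g

theorem IsMinimalWeakUpperGradient.gradientLpNorm_eq {p : ℝ} (hp : 0 ≤ p) {μ : Measure Y}
    {u : Y → EReal} {g : Y → ℝ≥0∞} (h : IsMinimalWeakUpperGradient p μ u g) :
    gradientLpNorm p μ g = minimalGradientNorm p μ u := by
  refine le_antisymm (le_iInf₂ fun g' hg' => ?_) (iInf₂_le_of_le g h.1 le_rfl)
  rcases eq_or_ne (gradientLpNorm p μ g') ⊤ with htop | htop
  · rw [htop]; exact le_top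
  · refine ENNReal.rpow_le_rpow (lintegral_mono_ae ?_) (by positivity)
    filter_upwards [h.2.2 g' hg' htop.lt_top] with x hx
    exact ENNReal.rpow_le_rpow hx hp

/-- The space `Ñ^{1,p}(Y, μ)`. -/
def MemNewtonian (p : ℝ) (μ : Measure Y) (u : Y → EReal) : Prop :=
  AEMeasurable u μ ∧ ∫⁻ x, (u x).abs ^ p ∂μ < ⊤ ∧
    ∃ g, IsWeakUpperGradient p μ u g ∧ ∫⁻ x, g x ^ p ∂μ < ⊤

/-- The Newtonian seminorm. -/
noncomputable def newtonianNorm (p : ℝ) (μ : Measure Y) (u : Y → EReal) : ℝ≥0∞ :=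
  (∫⁻ x, (u x).abs ^ p ∂μ + ⨅ (g : Y → ℝ≥0∞) (_ : IsUpperGradient u g), ∫⁻ x, g x ^ p ∂μ)
    ^ (1 / p)

/-- The Besov seminorm `‖u‖_{θ,p}`. -/
noncomputable def besovSeminorm (θ p : ℝ) (ν : Measure Y) (u : Y → ℝ) : ℝ≥0∞ :=
  (∫⁻ ζ, ∫⁻ ξ in {ζ}ᶜ, ENNReal.ofReal |u ζ - u ξ| ^ p /
    (ENNReal.ofReal (dist ζ ξ) ^ (p * θ) * ν (Metric.ball ζ (dist ζ ξ))) ∂ν ∂ν) ^ (1 / p)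

/-- The Besov space `B^θ_{p,p}(Y)`. -/
def MemBesov (θ p : ℝ) (ν : Measure Y) (u : Y → ℝ) : Prop :=
  MemLp u (ENNReal.ofReal p) ν ∧ besovSeminorm θ p ν u < ⊤

/-- `ν` is doubling: `0 < ν(2B) ≤ C ν(B) < ∞` for all balls `B`. -/
def IsDoublingMeasure (ν : Measure Y) : Prop :=
  ∃ C : ℝ≥0, ∀ (z : Y) (r : ℝ), 0 < r → 0 < ν (Metric.ball z (2 * r)) ∧
    ν (Metric.ball z (2 * r)) ≤ C * ν (Metric.ball z r) ∧ ν (Metric.ball z r) < ⊤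

end FunctionSpaces

/-! ### Arc-length parametrization of Lipschitz curves -/

section LipschitzCurves

variable {Y : Type*} [MetricSpace Y]

/-! The function is discretized: only its values at the vertices matter for the trace, and their
differences along edges are controlled by the gradient. Every edge has positive `mu`-mass, so a
function in `L^p` is integrable along it. Hence no nonconstant subarc of an edge starting at a
vertex is exceptional, and the weak upper gradient inequality holds there (`erealGap_edge_le`). An
edge at level `n` has `d_ε`-length at most `α² α⁻ⁿ`. With Jensen's inequality and `s = 1 - β/(εp)`
the weights match exactly, `α^{nps} α^{-np} = e^{-βn}`, so the discrete energy is bounded by `∫ g^p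
dμ_β` (`energy_le`).

By Tonelli the energy is the `ν`-integral of `∑ₙ α^{nps} levelSum n ζ`, and `levelSum n ζ ^ (1/p)`
dominates the difference of consecutive averages at `ζ`. The distance from the `n`-th average to the
limit is therefore at most the tail `tailSum n ζ`. As `α^s > 1`, a discrete Hardy inequality
(`lintegral_tsum_tailSum_le`) bounds the weighted tails by the energy. This gives a.e. convergence
and, because the average at level `0` is `u(v₀)`, the `L^p` bound.

For the Besov seminorm take `α^{-(n+1)} < d(ζ, ξ) ≤ α^{-n}`. A fixed number `l` of levels below `n`,
with `α^{-l} < τ - 1`, the vertices near `ζ` and `ξ` coincide or are neighbors. So `|ũ(ζ) - ũ(ξ)|`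
is bounded by tails from level `n - l` at the two points (`edist_trace_le`). Doubling turns the
Besov kernel into mean value kernels over balls, which integrate out by Tonelli
(`exists_trace_estimate`).

For Lipschitz functions, vertices of level `n` near `ζ` are within `α² α⁻ⁿ` of each other, so the
averages have the same limit as the values along a sequence defining `Ψ(ζ)`. -/

theorem eVariationOn_Icc_le_of_lipschitzWith {f : ℝ → Y} {K : ℝ≥0} (hf : LipschitzWith K f)
    {x y : ℝ} (hxy : x ≤ y) : eVariationOn f (Icc x y) ≤ K * ENNReal.ofReal (y - x) := by
  have h1 := (hf.lipschitzOnWith (s := Icc x y)).comp_eVariationOn_le (g := id) (s := Icc x y)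
    (fun z hz => hz)
  have h2 : eVariationOn (id : ℝ → ℝ) (Icc x y ∩ Icc x y) = ENNReal.ofReal (id y - id x) :=
    (monotone_id.monotoneOn _).eVariationOn_eq (left_mem_Icc.2 hxy) (right_mem_Icc.2 hxy)
  rw [inter_self] at h2
  rw [h2] at h1
  exact h1

theorem lipschitzWith_variationOnFromTo {f : ℝ → Y} {K : ℝ≥0} (hf : LipschitzWith K f) :
    LipschitzWith K (variationOnFromTo f univ 0) := by
  have hb := hf.locallyBoundedVariationOn univ
  have key : ∀ x y : ℝ, x ≤ y →
      variationOnFromTo f univ 0 y - variationOnFromTo f univ 0 x ≤ K * (y - x) := by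
    intro x y hxy
    rw [variationOnFromTo.sub_right hb (mem_univ _) (mem_univ _) (mem_univ _),
      variationOnFromTo.eq_of_le _ _ hxy, univ_inter]
    refine ENNReal.toReal_le_of_le_ofReal (mul_nonneg K.coe_nonneg (sub_nonneg.2 hxy)) ?_
    rw [ENNReal.ofReal_mul K.coe_nonneg, ENNReal.ofReal_coe_nnreal]
    exact eVariationOn_Icc_le_of_lipschitzWith hf hxy
  have hm := variationOnFromTo.monotoneOn hb (mem_univ (0 : ℝ))
  refine LipschitzWith.of_dist_le_mul fun x y => ?_
  rw [Real.dist_eq, Real.dist_eq]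
  rcases le_total x y with h | h
  · rw [abs_sub_comm, abs_sub_comm x y, abs_of_nonneg (sub_nonneg.2 h),
      abs_of_nonneg (sub_nonneg.2 (hm (mem_univ _) (mem_univ _) h))]
    exact key x y h
  · rw [abs_of_nonneg (sub_nonneg.2 h),
      abs_of_nonneg (sub_nonneg.2 (hm (mem_univ _) (mem_univ _) h))]
    exact key y x h

/-- A Lipschitz curve has an arc-length parametrization, and curve integrals along it are
controlled by integrals with respect to the original parameter. -/
theorem exists_isArcLengthCurve_of_lipschitzWith {f : ℝ → Y} {K : ℝ≥0} (hf : LipschitzWith K f)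
    {t : ℝ} (ht : 0 ≤ t) :
    ∃ (γ : ℝ → Y) (L : ℝ), IsArcLengthCurve γ L ∧ γ 0 = f 0 ∧ γ L = f t ∧
      ∀ g : Y → ℝ≥0∞, arcIntegral g γ L ≤ K * ∫⁻ s in Icc 0 t, g (f s) := by
  set φ := variationOnFromTo f univ 0 with hφ
  have hb := hf.locallyBoundedVariationOn univ
  have hφL : LipschitzWith K φ := lipschitzWith_variationOnFromTo hf
  have hφm : Monotone φ := fun x y h =>
    variationOnFromTo.monotoneOn hb (mem_univ (0 : ℝ)) (mem_univ _) (mem_univ _) h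
  have hφ0 : φ 0 = 0 := variationOnFromTo.self _ _ _
  set γ := naturalParameterization f univ 0 with hγ
  have hγφ : ∀ s, γ (φ s) = f s := fun s =>
    edist_eq_zero.1 (edist_naturalParameterization_eq_zero hb (mem_univ _) (mem_univ s))
  -- The length function `φ` is continuous, so no arc-length parameter is skipped.
  have hsurj : Icc 0 (φ t) ⊆ φ '' Icc 0 t := by
    have := intermediate_value_Icc ht hφL.continuous.continuousOn
    rwa [hφ0] at this
  refine ⟨γ, φ t, ⟨?_, ?_⟩, ?_, hγφ t, fun g => ?_⟩
  · rw [← hφ0]; exact hφm ht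
  · have h1 := has_unit_speed_naturalParameterization f hb (mem_univ (0 : ℝ))
    intro x hx y hy
    have hmem : ∀ z ∈ Icc 0 (φ t), z ∈ φ '' univ := fun z hz =>
      image_mono (subset_univ _) (hsurj hz)
    have hsub : Icc x y ⊆ Icc 0 (φ t) := Icc_subset_Icc hx.1 hy.2
    rw [← h1 (hmem x hx) (hmem y hy), inter_eq_right.2 hsub,
      inter_eq_right.2 fun z hz => hmem z (hsub hz)]
  · have := hγφ 0
    rwa [hφ0] at this
  -- A `K`-Lipschitz map enlarges Lebesgue measure by at most the factor `K`. Comparing measures,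
  -- instead of changing variables, allows an arbitrary `g`: `lintegral_map_le` asks for no
  -- measurability, and weak upper gradients are only a.e. measurable.
  · have hle : (volume : Measure ℝ).restrict (Icc 0 (φ t)) ≤
        (K : ℝ≥0∞) • Measure.map φ (volume.restrict (Icc 0 t)) := by
      refine Measure.le_iff.2 fun E hE => ?_
      rw [Measure.restrict_apply hE, Measure.smul_apply, smul_eq_mul,
        Measure.map_apply hφL.continuous.measurable hE,
        Measure.restrict_apply (hφL.continuous.measurable hE)]
      have hsub : E ∩ Icc 0 (φ t) ⊆ φ '' (φ ⁻¹' E ∩ Icc 0 t) := by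
        rintro z ⟨hz, hz'⟩
        obtain ⟨s, hs, rfl⟩ := hsurj hz'
        exact ⟨s, ⟨hz, hs⟩, rfl⟩
      have := hφL.hausdorffMeasure_image_le (d := 1) zero_le_one (φ ⁻¹' E ∩ Icc 0 t)
      rw [hausdorffMeasure_real, ENNReal.rpow_one] at this
      exact (measure_mono hsub).trans this
    unfold arcIntegral
    calc ∫⁻ s in Icc 0 (φ t), g (γ s)
        ≤ ∫⁻ s, g (γ s) ∂((K : ℝ≥0∞) • Measure.map φ (volume.restrict (Icc 0 t))) :=
          lintegral_mono' hle le_rfl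
      _ = K * ∫⁻ s, g (γ s) ∂(Measure.map φ (volume.restrict (Icc 0 t))) := by
          rw [lintegral_smul_measure, smul_eq_mul]
      _ ≤ K * ∫⁻ s in Icc 0 t, g (γ (φ s)) := 
          mul_le_mul' le_rfl (lintegral_map_le (fun s => g (γ s)) φ)
      _ = K * ∫⁻ s in Icc 0 t, g (f s) := by simp only [hγφ]

/-- The same for curves parametrized by the unit interval. -/
theorem exists_isArcLengthCurve_of_lipschitzWith_unitInterval {c : I → Y} {K : ℝ≥0}
    (hc : LipschitzWith K c) (t : I) :
    ∃ (γ : ℝ → Y) (L : ℝ), IsArcLengthCurve γ L ∧ γ 0 = c 0 ∧ γ L = c t ∧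
      ∀ g : Y → ℝ≥0∞, arcIntegral g γ L ≤ K * ∫⁻ s, g (c s) := by
  have hf : LipschitzWith K (fun s : ℝ => c (projIcc 0 1 zero_le_one s)) := by
    have := hc.comp (LipschitzWith.projIcc (a := (0 : ℝ)) (b := 1) zero_le_one)
    rwa [mul_one] at this
  obtain ⟨γ, L, h1, h2, h3, h4⟩ := exists_isArcLengthCurve_of_lipschitzWith hf t.2.1
  refine ⟨γ, L, h1, ?_, ?_, fun g => (h4 g).trans ?_⟩
  · rw [h2, projIcc_left]; rfl
  · rw [h3, projIcc_val]
  · gcongr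
    calc ∫⁻ s in Icc 0 (t : ℝ), g (c (projIcc 0 1 zero_le_one s))
        ≤ ∫⁻ s in Icc (0 : ℝ) 1, g (c (projIcc 0 1 zero_le_one s)) :=
          lintegral_mono_set (Icc_subset_Icc_right t.2.2)
      _ = ∫⁻ s : I, g (c (projIcc 0 1 zero_le_one (s : ℝ))) :=
          (lintegral_subtype_comap measurableSet_Icc
            fun s : ℝ => g (c (projIcc 0 1 zero_le_one s))).symm
      _ = ∫⁻ s, g (c s) := by simp only [projIcc_val]

end LipschitzCurves

namespace HyperbolicFilling

variable {Z : Type*} [MetricSpace Z] {α τ : ℝ} (F : HyperbolicFilling Z α τ)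

/-! ### Edges of the uniformized filling -/

theorem alpha_pos (F : HyperbolicFilling Z α τ) : 0 < α := one_pos.trans F.one_lt_alpha

theorem level_le_of_adj {v w : F.Vertex} (h : F.graph.Adj v w) :
    |(v.1.2 : ℝ) - w.1.2| ≤ 1 := by
  rcases h.2 with ⟨h, _⟩ | ⟨h | h, _⟩ <;> rw [h] <;> simp

/-- The level of a point of the filling: the piecewise linear extension of `(z, n) ↦ n`. -/
noncomputable def pointLevel (x : GraphRealization F.graph) : ℝ :=
  ∑ᶠ u : F.Vertex, x.coord u * u.1.2

theorem finsum_edgeCoord_mul (v w : F.Vertex) (t : I) :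
    ∑ᶠ u : F.Vertex, edgeCoord v w t u * (u.1.2 : ℝ) =
      (1 - (t : ℝ)) * v.1.2 + t * w.1.2 := by
  classical
  have h1 : ∀ (v : F.Vertex) (c : ℝ),
      (Function.support fun u : F.Vertex => (if u = v then c else 0) * (u.1.2 : ℝ)) ⊆ {v} := by
    intro v c u hu
    by_contra hne
    exact hu (by simp [show u ≠ v from hne])
  have h2 : ∀ (v : F.Vertex) (c : ℝ),
      ∑ᶠ u : F.Vertex, (if u = v then c else 0) * (u.1.2 : ℝ) = c * v.1.2 := by
    intro v c
    rw [finsum_eq_single _ v fun u hu => by simp [hu]]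
    simp
  simp only [edgeCoord, add_mul]
  rw [finsum_add_distrib ((finite_singleton v).subset (by convert h1 v (1 - (t : ℝ))))
    ((finite_singleton w).subset (by convert h1 w (t : ℝ)))]
  exact congrArg₂ (· + ·) (by convert h2 v (1 - (t : ℝ))) (by convert h2 w (t : ℝ))

theorem pointLevel_edgePt {v w : F.Vertex} (h : F.graph.Adj v w) (t : I) :
    F.pointLevel (GraphRealization.edgePt h t) = (1 - (t : ℝ)) * v.1.2 + t * w.1.2 :=
  F.finsum_edgeCoord_mul v w t

theorem pointLevel_vertexPt (v : F.Vertex) :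
    F.pointLevel (GraphRealization.vertexPt F.graph v) = v.1.2 := by
  have := F.finsum_edgeCoord_mul v v 0
  simpa [pointLevel, GraphRealization.vertexPt] using this

/-- The level is affine on each edge with slope at most `1` in absolute value. This yields the lower
bound for the distance to the root, hence upper bounds for the density. -/
theorem abs_pointLevel_sub_le {x y : GraphRealization F.graph} {a : ℝ≥0}
    (h : GraphRealization.PLPath F.graph x y a) : |F.pointLevel x - F.pointLevel y| ≤ a := by
  induction h with
  | nil x => simp
  | @cons v w h s t x y z ℓ hx hy _ ih =>
    subst hx hy
    have h1 : |F.pointLevel (GraphRealization.edgePt h s) -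
        F.pointLevel (GraphRealization.edgePt h t)| ≤ nndist s t := by
      rw [pointLevel_edgePt, pointLevel_edgePt,
        show (1 - (s : ℝ)) * v.1.2 + s * w.1.2 - ((1 - (t : ℝ)) * v.1.2 + t * w.1.2)
          = ((s : ℝ) - t) * (w.1.2 - v.1.2) by ring, abs_mul, coe_nndist, Subtype.dist_eq,
        Real.dist_eq]
      have := F.level_le_of_adj h.symm
      exact mul_le_of_le_one_right (abs_nonneg _) this
    rw [NNReal.coe_add]
    exact (abs_sub_le _ _ _).trans (add_le_add h1 ih)

theorem level_le_dist_rootPt (v : F.Vertex) :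
    (v.1.2 : ℝ) ≤ dist (α := F.Space) (GraphRealization.vertexPt F.graph v) F.rootPt := by
  have h1 : ENNReal.ofReal v.1.2 ≤
      edist (α := F.Space) (GraphRealization.vertexPt F.graph v) F.rootPt := by
    change _ ≤ edist (GraphRealization.vertexPt F.graph v)
      (GraphRealization.vertexPt F.graph F.root)
    rw [GraphRealization.edist_def]
    refine le_iInf₂ fun ℓ hl => ENNReal.ofReal_le_of_le_toReal ?_
    have h2 := F.abs_pointLevel_sub_le hl
    rw [pointLevel_vertexPt, pointLevel_vertexPt] at h2
    have h3 : (F.root.1.2 : ℝ) = 0 := by simp [root]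
    rw [h3, sub_zero] at h2
    exact (le_abs_self _).trans h2
  exact (ENNReal.ofReal_le_ofReal_iff dist_nonneg).1
    (h1.trans (edist_dist (α := F.Space) _ _).le)

/-- The Lipschitz constant of the edges starting in level `n`, with respect to `d_ε`. -/
noncomputable def edgeLip (_F : HyperbolicFilling Z α τ) (n : ℕ) : ℝ≥0 :=
  Real.toNNReal (α ^ 2 * (α ^ n)⁻¹)

theorem coe_edgeLip (n : ℕ) : (F.edgeLip n : ℝ) = α ^ 2 * (α ^ n)⁻¹ :=
  Real.coe_toNNReal _ (by have := F.alpha_pos; positivity)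

/-- The segment of the edge competes in the infimum defining `d_ε`. Its points have distance at
least `n - 2` from the root: one unit is lost from `v` to the starting point and one along the
segment. So the density is at most `α^{2-n}`. -/
theorem lipschitzWith_edgePt {ε : ℝ} (hε : ε = Real.log α) {v w : F.Vertex}
    (h : F.graph.Adj v w) : LipschitzWith (F.edgeLip v.1.2) (F.edgePt ε h) := by
  intro s t
  have hα := F.alpha_pos
  have hε0 : 0 ≤ ε := hε ▸ Real.log_nonneg F.one_lt_alpha.le
  obtain ⟨γ, h1, h2, h3⟩ := GraphRealization.exists_arc_edgePt h s t
  have h0 : edist (F.edgePt ε h s) (F.edgePt ε h t) ≤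
      arcIntegral (uniformizingDensity (X := F.Space) ε F.rootPt) γ (dist s t) :=
    uniformizedEDist_le (X := F.Space) h1 h2 h3
  refine h0.trans ?_
  have hd1 : dist s t ≤ 1 := by
    rw [Subtype.dist_eq, Real.dist_eq, abs_le]
    constructor <;> linarith [s.2.1, s.2.2, t.2.1, t.2.2]
  have hb : ∀ r ∈ Icc 0 (dist s t),
      uniformizingDensity (X := F.Space) ε F.rootPt (γ r) ≤ F.edgeLip v.1.2 := by
    intro r hr
    have e1 : dist (α := F.Space) (γ 0) (γ r) ≤ r :=
      IsArcLengthCurve.dist_le (X := F.Space) h1 hr.1 hr.2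
    have e2 : dist (α := F.Space) (GraphRealization.vertexPt F.graph v) (γ 0) ≤ 1 := by
      have : edist (GraphRealization.edgePt h 0) (GraphRealization.edgePt h s) = edist 0 s :=
        GraphRealization.edist_edgePt h 0 s
      rw [GraphRealization.edgePt_zero, ← h2] at this
      have e3 : edist (α := F.Space) (GraphRealization.vertexPt F.graph v) (γ 0) = edist 0 s :=
        this
      have e4 := (ENNReal.ofReal_eq_ofReal_iff dist_nonneg dist_nonneg).1
        (((edist_dist (α := F.Space) _ _).symm.trans e3).trans (edist_dist _ _))
      rw [e4, dist_comm, Subtype.dist_eq, Real.dist_eq]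
      simpa [abs_of_nonneg s.2.1] using s.2.2
    have e5 := F.level_le_dist_rootPt v
    have e6 := dist_triangle4 (α := F.Space) (GraphRealization.vertexPt F.graph v) (γ 0) (γ r)
      F.rootPt
    have e7 : (v.1.2 : ℝ) - 2 ≤ dist (α := F.Space) (γ r) F.rootPt := by linarith [hr.2]
    unfold uniformizingDensity edgeLip
    refine ENNReal.ofReal_le_ofReal ?_
    have e8 : -ε * dist (α := F.Space) (γ r) F.rootPt ≤ Real.log α * (2 - v.1.2) := by
      rw [← hε]; nlinarith
    calc Real.exp (-ε * dist (α := F.Space) (γ r) F.rootPt)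
        ≤ Real.exp (Real.log α * (2 - v.1.2)) := Real.exp_le_exp.2 e8
      _ = α ^ 2 * (α ^ v.1.2)⁻¹ := by
        rw [← Real.rpow_def_of_pos hα, Real.rpow_sub hα, Real.rpow_natCast, div_eq_mul_inv]
        norm_num
  unfold arcIntegral
  calc ∫⁻ r in Icc 0 (dist s t), uniformizingDensity (X := F.Space) ε F.rootPt (γ r)
      ≤ ∫⁻ _ in Icc 0 (dist s t), (F.edgeLip v.1.2 : ℝ≥0∞) :=
        setLIntegral_mono' measurableSet_Icc hb
    _ = F.edgeLip v.1.2 * edist s t := by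
      rw [setLIntegral_const, Real.volume_Icc, sub_zero, edist_dist]

theorem edgePt_zero (ε : ℝ) {v w : F.Vertex} (h : F.graph.Adj v w) :
    F.edgePt ε h 0 = F.vertexPt ε v := GraphRealization.edgePt_zero h

theorem edgePt_one (ε : ℝ) {v w : F.Vertex} (h : F.graph.Adj v w) :
    F.edgePt ε h 1 = F.vertexPt ε w := GraphRealization.edgePt_one h

theorem edgePt_injective (ε : ℝ) {v w : F.Vertex} (h : F.graph.Adj v w) :
    Function.Injective (F.edgePt ε h) := by
  intro s t hst
  have h1 := GraphRealization.edist_edgePt h s t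
  have h2 : GraphRealization.edgePt h s = GraphRealization.edgePt h t := hst
  rw [h2, edist_self] at h1
  exact edist_eq_zero.1 h1.symm

theorem dist_vertexPt_le {ε : ℝ} (hε : ε = Real.log α) {v w : F.Vertex}
    (h : F.graph.Adj v w) :
    dist (F.vertexPt ε v) (F.vertexPt ε w) ≤ α ^ 2 * (α ^ v.1.2)⁻¹ := by
  have h1 := (F.lipschitzWith_edgePt hε h).dist_le_mul 0 1
  rw [edgePt_zero, edgePt_one, coe_edgeLip] at h1
  simpa [Subtype.dist_eq] using h1

/-- Two vertices of the same level whose defining balls are close are equal or adjacent. -/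
theorem eq_or_adj_of_dist_lt {n : ℕ} {ζ ξ : Z} {v w : F.Vertex} (hv : v.1.2 = n) (hw : w.1.2 = n)
    (hvζ : dist v.1.1 ζ < (α ^ n)⁻¹) (hwξ : dist w.1.1 ξ < (α ^ n)⁻¹)
    (hζξ : dist ζ ξ ≤ (τ - 1) * (α ^ n)⁻¹) : v = w ∨ F.graph.Adj v w := by
  have hpos : 0 < (α ^ n)⁻¹ := inv_pos.2 (pow_pos F.alpha_pos n)
  have hτ := F.one_lt_tau
  -- The point `ζ` lies in both balls of radius `τ α⁻ⁿ`; the room for this is `τ - 1 > 0`.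
  refine or_iff_not_imp_left.2 fun hne => ⟨hne, Or.inl ⟨hv.trans hw.symm, ζ, ?_, ?_⟩⟩
  · rw [Metric.mem_ball, dist_comm, hv]
    nlinarith
  · rw [Metric.mem_ball, hw]
    have := dist_triangle ζ ξ w.1.1
    rw [dist_comm ξ] at this
    linarith

theorem adj_of_level_succ {n : ℕ} {ζ : Z} {v w : F.Vertex} (hv : v.1.2 = n)
    (hw : w.1.2 = n + 1) (hvζ : dist v.1.1 ζ < (α ^ n)⁻¹)
    (hwζ : dist w.1.1 ζ < (α ^ (n + 1))⁻¹) : F.graph.Adj v w := by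
  refine ⟨fun h => ?_, Or.inr ⟨Or.inr (by omega), ζ, ?_, ?_⟩⟩
  · rw [h] at hv; omega
  · rw [Metric.mem_ball, dist_comm, hv]; exact hvζ
  · rw [Metric.mem_ball, dist_comm, hw]; exact hwζ

end HyperbolicFilling

/-! ### Newtonian functions on the filling -/

theorem erealGap_of_ne {a b : EReal} (ha : a ≠ ⊥ ∧ a ≠ ⊤) (hb : b ≠ ⊥ ∧ b ≠ ⊤) :
    erealGap a b = ENNReal.ofReal |a.toReal - b.toReal| := by
  rw [erealGap, if_neg]
  simp [ha.1, ha.2, hb.1, hb.2]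

theorem ne_of_erealGap_ne_top {a b : EReal} (h : erealGap a b ≠ ⊤) :
    (a ≠ ⊥ ∧ a ≠ ⊤) ∧ (b ≠ ⊥ ∧ b ≠ ⊤) := by
  by_contra hcon
  refine h (if_pos ?_)
  by_contra h2
  push Not at h2
  exact hcon ⟨⟨h2.1, h2.2.1⟩, h2.2.2⟩

theorem EReal.abs_eq_ofReal {a : EReal} (ha : a ≠ ⊥ ∧ a ≠ ⊤) :
    a.abs = ENNReal.ofReal |a.toReal| := by
  lift a to ℝ using ⟨ha.2, ha.1⟩
  rfl

/-- Jensen's inequality for powers on a probability space. -/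
theorem lintegral_rpow_le_of_isProbabilityMeasure {Ω : Type*} [MeasurableSpace Ω] {P : Measure Ω}
    [IsProbabilityMeasure P] {p : ℝ} (hp : 1 ≤ p) {f : Ω → ℝ≥0∞} (hf : AEMeasurable f P) :
    (∫⁻ x, f x ∂P) ^ p ≤ ∫⁻ x, f x ^ p ∂P := by
  have hp0 : 0 < p := by linarith
  have h := eLpNorm'_le_eLpNorm'_of_exponent_le one_pos hp P hf.aestronglyMeasurable
  simp only [eLpNorm'_eq_lintegral_enorm, enorm_eq_self, ENNReal.rpow_one, div_one] at h
  calc (∫⁻ x, f x ∂P) ^ p ≤ ((∫⁻ x, f x ^ p ∂P) ^ (1 / p)) ^ p :=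
        ENNReal.rpow_le_rpow h hp0.le
    _ = ∫⁻ x, f x ^ p ∂P := by
        rw [← ENNReal.rpow_mul, one_div_mul_cancel hp0.ne', ENNReal.rpow_one]

/-- The origin of the critical exponent `1 - β/(εp)`: with it, the energy weight times the `p`-th
power of the edge length is the exponential factor of `vertexWeight`. -/
theorem pow_rpow_mul_inv_rpow_eq_exp {α β p : ℝ} (hα : 1 < α) (hp : p ≠ 0) (n : ℕ) :
    ((α ^ (1 - β / (Real.log α * p))) ^ n) ^ p * (α ^ n)⁻¹ ^ p = Real.exp (-β * n) := by
  obtain ⟨ε, rfl⟩ : ∃ ε, α = Real.exp ε := ⟨_, (Real.exp_log (one_pos.trans hα)).symm⟩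
  have hε : ε ≠ 0 := by rintro rfl; simp at hα
  rw [Real.log_exp]
  simp only [← Real.exp_mul, ← Real.exp_nat_mul, ← Real.exp_neg, ← Real.exp_add]
  congr 1
  field_simp
  ring

namespace HyperbolicFilling

variable {Z : Type*} [MetricSpace Z] {α τ : ℝ} (F : HyperbolicFilling Z α τ)

theorem exists_adj (v : F.Vertex) : ∃ w, F.graph.Adj v w := by
  refine ⟨⟨(v.1.1, v.1.2 + 1), F.A_mono (Nat.le_succ _) v.2⟩, ?_⟩
  have hα := F.alpha_pos
  refine F.adj_of_level_succ (ζ := v.1.1) rfl rfl ?_ ?_ <;> rw [dist_self] <;> positivity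

variable [MeasurableSpace Z]

theorem vertexWeight_ne_zero {ν : Measure Z} (hν : ∀ z, ∀ r > 0, ν (Metric.ball z r) ≠ 0) (β : ℝ)
    (v : F.Vertex) : F.vertexWeight β ν v ≠ 0 := by
  have hα := F.alpha_pos
  refine mul_ne_zero ?_ (hν _ _ (by positivity))
  exact (ENNReal.ofReal_pos.2 (Real.exp_pos _)).ne'

/-- The pushforward of Lebesgue measure to an edge is a summand of `mu` up to a nonzero weight, so
properties holding `mu`-a.e. restrict to each single edge. -/
theorem aemeasurable_comp_edgePt {ε β : ℝ} (hε : ε = Real.log α) {ν : Measure Z}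
    (hν : ∀ z, ∀ r > 0, ν (Metric.ball z r) ≠ 0) {S : Type*} [MeasurableSpace S]
    {f : F.Unif ε → S} (hf : AEMeasurable f (F.mu ε β ν)) {v w : F.Vertex}
    (h : F.graph.Adj v w) :
    AEMeasurable f (Measure.map (F.edgePt ε h) volume) ∧
      AEMeasurable (fun s => f (F.edgePt ε h s)) volume := by
  have h1 := (hf.mono_measure (Measure.le_sum _ v)).mono_measure (Measure.le_sum _ ⟨w, h⟩)
  rw [aemeasurable_smul_measure_iff] at h1
  · exact ⟨h1, h1.comp_measurable (F.lipschitzWith_edgePt hε h).continuous.measurable⟩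
  · exact fun h0 => F.vertexWeight_ne_zero hν β v (add_eq_zero.1 h0).1

theorem lintegral_mu {ε β : ℝ} (hε : ε = Real.log α) {ν : Measure Z}
    (hν : ∀ z, ∀ r > 0, ν (Metric.ball z r) ≠ 0)
    {f : F.Unif ε → ℝ≥0∞} (hf : AEMeasurable f (F.mu ε β ν)) :
    ∫⁻ x, f x ∂F.mu ε β ν = ∑' v : F.Vertex, ∑' w : {w // F.graph.Adj v w},
      (F.vertexWeight β ν v + F.vertexWeight β ν w.1) * ∫⁻ s, f (F.edgePt ε w.2 s) := by
  unfold mu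
  rw [lintegral_sum_measure]
  refine tsum_congr fun v => ?_
  rw [lintegral_sum_measure]
  refine tsum_congr fun w => ?_
  rw [lintegral_smul_measure, smul_eq_mul,
    lintegral_map' (F.aemeasurable_comp_edgePt hε hν hf w.2).1
      (F.lipschitzWith_edgePt hε w.2).continuous.measurable.aemeasurable]

theorem vertexWeight_mul_lintegral_edge_le {ε β : ℝ} (hε : ε = Real.log α) {ν : Measure Z}
    (hν : ∀ z, ∀ r > 0, ν (Metric.ball z r) ≠ 0)
    {f : F.Unif ε → ℝ≥0∞} (hf : AEMeasurable f (F.mu ε β ν)) {v w : F.Vertex}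
    (h : F.graph.Adj v w) :
    F.vertexWeight β ν v * ∫⁻ s, f (F.edgePt ε h s) ≤ ∫⁻ x, f x ∂F.mu ε β ν := by
  rw [F.lintegral_mu hε hν hf]
  refine le_trans ?_ (ENNReal.le_tsum v)
  refine le_trans ?_ (ENNReal.le_tsum (⟨w, h⟩ : {w // F.graph.Adj v w}))
  gcongr
  exact le_self_add

variable {F}

/-- A weak upper gradient controls the function along edges. -/
theorem erealGap_edge_le {ε β p : ℝ} (hε : ε = Real.log α) (hp : 1 ≤ p) {ν : Measure Z}
    (hν : ∀ z, ∀ r > 0, ν (Metric.ball z r) ≠ 0) {u : F.Unif ε → EReal} {g : F.Unif ε → ℝ≥0∞}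
    (hg : IsWeakUpperGradient p (F.mu ε β ν) u g) {v w : F.Vertex} (h : F.graph.Adj v w) {t : I}
    (ht : t ≠ 0) :
    erealGap (u (F.vertexPt ε v)) (u (F.edgePt ε h t)) ≤
      F.edgeLip v.1.2 * ∫⁻ s, g (F.edgePt ε h s) := by
  obtain ⟨ρ, hρm, hρ, hρc⟩ := hg.2
  obtain ⟨γ, L, h1, h2, h3, h4⟩ :=
    exists_isArcLengthCurve_of_lipschitzWith_unitInterval (F.lipschitzWith_edgePt hε h) t
  rw [edgePt_zero] at h2
  -- Since `t ≠ 0` and edges are embedded, the arc is nonconstant, as the definition of a weak upper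
  -- gradient requires.
  have hL : 0 < L := by
    refine h1.1.lt_of_ne fun h0 => ht (F.edgePt_injective ε h ?_)
    rw [edgePt_zero, ← h2, ← h3, h0]
  -- The weight of the edge is positive, so `ρ` is `p`-integrable, hence integrable, along it. An
  -- exceptional arc would need `∫ ρ = ∞`.
  have hfin : ∫⁻ s, ρ (F.edgePt ε h s) ^ p < ⊤ := by
    have := F.vertexWeight_mul_lintegral_edge_le hε hν (β := β)
      (hρm.pow_const p).aemeasurable h
    by_contra htop
    rw [not_lt, top_le_iff] at htop
    rw [htop, ENNReal.mul_top (F.vertexWeight_ne_zero hν β v)] at this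
    exact absurd (this.trans_lt hρ) (lt_irrefl _)
  have hfin1 : ∫⁻ s, ρ (F.edgePt ε h s) ≠ ⊤ := by
    have h5 := lintegral_rpow_le_of_isProbabilityMeasure hp
      (F.aemeasurable_comp_edgePt hε hν (β := β) hρm.aemeasurable h).2
    intro htop
    rw [htop, ENNReal.top_rpow_of_pos (by linarith)] at h5
    exact absurd (h5.trans_lt hfin) (lt_irrefl _)
  by_contra hcon
  have h6 : arcIntegral ρ γ L = ⊤ := by
    refine hρc γ L hL h1 fun h7 => hcon ?_
    beta_reduce at h7
    rw [h2, h3] at h7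
    exact h7.trans (h4 g)
  have h7 := h4 ρ
  rw [h6, top_le_iff] at h7
  exact ENNReal.mul_ne_top ENNReal.coe_ne_top hfin1 h7

theorem lintegral_edge_ne_top {ε β p : ℝ} (hε : ε = Real.log α) (hp : 1 ≤ p) {ν : Measure Z}
    (hν : ∀ z, ∀ r > 0, ν (Metric.ball z r) ≠ 0) {g : F.Unif ε → ℝ≥0∞}
    (hgm : AEMeasurable g (F.mu ε β ν)) (hg : ∫⁻ x, g x ^ p ∂F.mu ε β ν ≠ ⊤)
    {v w : F.Vertex} (h : F.graph.Adj v w) : ∫⁻ s, g (F.edgePt ε h s) ≠ ⊤ := by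
  intro htop
  have h5 := lintegral_rpow_le_of_isProbabilityMeasure hp
    (F.aemeasurable_comp_edgePt hε hν hgm h).2
  rw [htop, ENNReal.top_rpow_of_pos (by linarith), top_le_iff] at h5
  have := F.vertexWeight_mul_lintegral_edge_le hε hν (hgm.pow_const p) h
  rw [h5, ENNReal.mul_top (F.vertexWeight_ne_zero hν β v), top_le_iff] at this
  exact hg this

/-- Newtonian functions on the filling are real-valued. -/
theorem ne_bot_ne_top {ε β p : ℝ} (hε : ε = Real.log α) (hp : 1 ≤ p) {ν : Measure Z}
    (hν : ∀ z, ∀ r > 0, ν (Metric.ball z r) ≠ 0) {u : F.Unif ε → EReal} {g : F.Unif ε → ℝ≥0∞}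
    (hg : IsWeakUpperGradient p (F.mu ε β ν) u g) (hgp : ∫⁻ x, g x ^ p ∂F.mu ε β ν ≠ ⊤)
    (x : F.Unif ε) : u x ≠ ⊥ ∧ u x ≠ ⊤ := by
  have key : ∀ {v w : F.Vertex} (h : F.graph.Adj v w) {t : I} (_ : t ≠ 0),
      erealGap (u (F.vertexPt ε v)) (u (F.edgePt ε h t)) ≠ ⊤ := fun h t ht =>
    ne_top_of_le_ne_top (ENNReal.mul_ne_top ENNReal.coe_ne_top
      (lintegral_edge_ne_top hε hp hν hg.1 hgp h)) (erealGap_edge_le hε hp hν hg h ht)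
  have hvert : ∀ v, u (F.vertexPt ε v) ≠ ⊥ ∧ u (F.vertexPt ε v) ≠ ⊤ := fun v => by
    obtain ⟨w, h⟩ := F.exists_adj v
    exact (ne_of_erealGap_ne_top (key h one_ne_zero)).1
  rcases GraphRealization.eq_vertexPt_or_edgePt x with ⟨v, rfl⟩ | ⟨v, w, h, t, rfl⟩
  · exact hvert v
  · change u (F.edgePt ε h t) ≠ ⊥ ∧ u (F.edgePt ε h t) ≠ ⊤
    by_cases ht : t = 0
    · rw [ht, edgePt_zero]; exact hvert v
    · exact (ne_of_erealGap_ne_top (key h ht)).2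

/-! ### The discrete energy and its bound by the gradient -/

variable (F) in
/-- The discrete energy `∑ₙ ∑_{v = (z, n)} α^{n p s} ν(B(z, α⁻ⁿ)) ∑_{w ∼ v} |U v - U w|^p`. -/
noncomputable def energy (p s : ℝ) (ν : Measure Z) (U : F.Vertex → ℝ) : ℝ≥0∞ :=
  ∑' v : F.Vertex, (ENNReal.ofReal (α ^ s) ^ v.1.2) ^ p * (ν (Metric.ball v.1.1 (α ^ v.1.2)⁻¹) *
    ∑' w : {w // F.graph.Adj v w}, ENNReal.ofReal |U v - U w.1| ^ p)

/-- Both sides are sums over oriented edges and are compared term by term: the gradient inequality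
on one edge is raised to the power `p` by Jensen, and the powers of `α` combine to `e^{-βn}`. -/
theorem energy_le {ε β p : ℝ} (hε : ε = Real.log α) (hp : 1 ≤ p) {ν : Measure Z}
    (hν : ∀ z, ∀ r > 0, ν (Metric.ball z r) ≠ 0) {u : F.Unif ε → EReal}
    (hu : ∀ x, u x ≠ ⊥ ∧ u x ≠ ⊤) {g : F.Unif ε → ℝ≥0∞}
    (hg : IsWeakUpperGradient p (F.mu ε β ν) u g) :
    F.energy p (1 - β / (ε * p)) ν (fun v => (u (F.vertexPt ε v)).toReal) ≤
      ENNReal.ofReal (α ^ 2) ^ p * ∫⁻ x, g x ^ p ∂F.mu ε β ν := by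
  have hα := F.alpha_pos
  have hε0 : 0 < ε := hε ▸ Real.log_pos F.one_lt_alpha
  rw [F.lintegral_mu hε hν (hg.1.pow_const p), energy, ← ENNReal.tsum_mul_left]
  refine ENNReal.tsum_le_tsum fun v => ?_
  rw [← ENNReal.tsum_mul_left, ← ENNReal.tsum_mul_left, ← ENNReal.tsum_mul_left]
  refine ENNReal.tsum_le_tsum fun w => ?_
  have h1 := erealGap_edge_le hε hp hν hg w.2 one_ne_zero
  rw [edgePt_one, erealGap_of_ne (hu _) (hu _)] at h1
  have h2 := lintegral_rpow_le_of_isProbabilityMeasure hp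
    (F.aemeasurable_comp_edgePt hε hν hg.1 w.2).2
  have h3 : ENNReal.ofReal |(u (F.vertexPt ε v)).toReal - (u (F.vertexPt ε w.1)).toReal| ^ p ≤
      (F.edgeLip v.1.2 : ℝ≥0∞) ^ p * ∫⁻ s, g (F.edgePt ε w.2 s) ^ p := by
    refine (ENNReal.rpow_le_rpow h1 (by linarith)).trans ?_
    rw [ENNReal.mul_rpow_of_nonneg _ _ (by linarith)]
    gcongr
  have h4 : (ENNReal.ofReal (α ^ (1 - β / (ε * p))) ^ v.1.2) ^ p * (F.edgeLip v.1.2 : ℝ≥0∞) ^ p =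
      ENNReal.ofReal (α ^ 2) ^ p * ENNReal.ofReal (Real.exp (-β * v.1.2)) := by
    have hp0 : 0 ≤ p := by linarith
    have hc : (F.edgeLip v.1.2 : ℝ≥0∞) = ENNReal.ofReal (α ^ 2 * (α ^ v.1.2)⁻¹) := rfl
    rw [hc, ← ENNReal.ofReal_pow (by positivity), ENNReal.ofReal_rpow_of_nonneg (by positivity) hp0,
      ENNReal.ofReal_rpow_of_nonneg (by positivity) hp0,
      ENNReal.ofReal_rpow_of_nonneg (by positivity) hp0, ← ENNReal.ofReal_mul (by positivity),
      ← ENNReal.ofReal_mul (by positivity)]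
    congr 1
    rw [Real.mul_rpow (by positivity) (by positivity), mul_left_comm]
    congr 1
    rw [hε]
    exact pow_rpow_mul_inv_rpow_eq_exp F.one_lt_alpha (by linarith) _
  calc _ ≤ (ENNReal.ofReal (α ^ (1 - β / (ε * p))) ^ v.1.2) ^ p *
        (ν (Metric.ball v.1.1 (α ^ v.1.2)⁻¹) *
          ((F.edgeLip v.1.2 : ℝ≥0∞) ^ p * ∫⁻ s, g (F.edgePt ε w.2 s) ^ p)) := by gcongr
    _ = ((ENNReal.ofReal (α ^ (1 - β / (ε * p))) ^ v.1.2) ^ p * (F.edgeLip v.1.2 : ℝ≥0∞) ^ p) *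
        (ν (Metric.ball v.1.1 (α ^ v.1.2)⁻¹) * ∫⁻ s, g (F.edgePt ε w.2 s) ^ p) := by ring
    _ = ENNReal.ofReal (α ^ 2) ^ p *
        (F.vertexWeight β ν v * ∫⁻ s, g (F.edgePt ε w.2 s) ^ p) := by
      rw [h4, vertexWeight]; ring
    _ ≤ _ := by
      gcongr
      exact le_self_add

end HyperbolicFilling

/-! ### Control of vertex values by the Newtonian norm -/

namespace HyperbolicFilling

variable {Z : Type*} [MetricSpace Z] {α τ : ℝ} (F : HyperbolicFilling Z α τ) [MeasurableSpace Z]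

theorem lintegral_edge_le {ε β p : ℝ} (hε : ε = Real.log α) (hp : 1 ≤ p) {ν : Measure Z}
    (hν : ∀ z, ∀ r > 0, ν (Metric.ball z r) ≠ 0) (hν' : ∀ z r, ν (Metric.ball z r) ≠ ⊤)
    {f : F.Unif ε → ℝ≥0∞} (hf : AEMeasurable f (F.mu ε β ν)) {v w : F.Vertex}
    (h : F.graph.Adj v w) : ∫⁻ s, f (F.edgePt ε h s) ≤
      ((F.vertexWeight β ν v)⁻¹ * ∫⁻ x, f x ^ p ∂F.mu ε β ν) ^ (1 / p) := by
  have hp0 : 0 < p := by linarith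
  rw [one_div, ENNReal.le_rpow_inv_iff hp0]
  refine (lintegral_rpow_le_of_isProbabilityMeasure hp
    (F.aemeasurable_comp_edgePt hε hν hf h).2).trans ?_
  have h1 : F.vertexWeight β ν v ≠ ⊤ := ENNReal.mul_ne_top ENNReal.ofReal_ne_top (hν' _ _)
  rw [mul_comm, ← div_eq_mul_inv, ENNReal.le_div_iff_mul_le
    (Or.inl (F.vertexWeight_ne_zero hν β v)) (Or.inl h1), mul_comm]
  exact F.vertexWeight_mul_lintegral_edge_le hε hν (hf.pow_const p) h

/-- The value at a vertex is controlled by the Newtonian norm. -/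
theorem exists_abs_vertexPt_le {ε β p : ℝ} (hε : ε = Real.log α) (hp : 1 ≤ p) {ν : Measure Z}
    (hν : ∀ z, ∀ r > 0, ν (Metric.ball z r) ≠ 0) (hν' : ∀ z r, ν (Metric.ball z r) ≠ ⊤)
    (v : F.Vertex) :
    ∃ C : ℝ≥0, ∀ u : F.Unif ε → EReal, AEMeasurable u (F.mu ε β ν) →
      (∀ x, u x ≠ ⊥ ∧ u x ≠ ⊤) → ∀ g, IsWeakUpperGradient p (F.mu ε β ν) u g →
        (u (F.vertexPt ε v)).abs ≤
          C * (∫⁻ x, (u x).abs ^ p ∂F.mu ε β ν + ∫⁻ x, g x ^ p ∂F.mu ε β ν) ^ (1 / p) := by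
  obtain ⟨w, h⟩ := F.exists_adj v
  have hp0 : 0 ≤ 1 / p := by positivity
  refine ⟨(1 + F.edgeLip v.1.2) * ((F.vertexWeight β ν v)⁻¹.toNNReal) ^ (1 / p),
    fun u hum hu g hg => ?_⟩
  set S := ∫⁻ x, (u x).abs ^ p ∂F.mu ε β ν + ∫⁻ x, g x ^ p ∂F.mu ε β ν with hS
  set a := (u (F.vertexPt ε v)).abs with ha
  have habs : AEMeasurable (fun x => (u x).abs) (F.mu ε β ν) := by
    simp only [EReal.abs_eq_ofReal (hu _)]
    exact (hum.ereal_toReal.abs).ennreal_ofReal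
  -- The value at the vertex is compared with the value at every point of one adjacent edge, then
  -- averaged over that edge. The point `s = 0` is separate because its arc is constant.
  have hpt : ∀ s, a ≤ (u (F.edgePt ε h s)).abs +
      F.edgeLip v.1.2 * ∫⁻ s, g (F.edgePt ε h s) := by
    intro s
    by_cases hs : s = 0
    · rw [hs, edgePt_zero]; exact le_self_add
    · refine le_trans ?_ (add_le_add_right (erealGap_edge_le hε hp hν hg h hs) _)
      rw [erealGap_of_ne (hu _) (hu _), ha, EReal.abs_eq_ofReal (hu _),
        EReal.abs_eq_ofReal (hu _), ← ENNReal.ofReal_add (abs_nonneg _) (abs_nonneg _)]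
      refine ENNReal.ofReal_le_ofReal ?_
      have := abs_sub_abs_le_abs_sub (u (F.vertexPt ε v)).toReal (u (F.edgePt ε h s)).toReal
      linarith
  have h1 : a ≤ (∫⁻ s, (u (F.edgePt ε h s)).abs) +
      F.edgeLip v.1.2 * ∫⁻ s, g (F.edgePt ε h s) := by
    calc a = ∫⁻ _ : I, a := by simp
      _ ≤ ∫⁻ s, ((u (F.edgePt ε h s)).abs + F.edgeLip v.1.2 * ∫⁻ s, g (F.edgePt ε h s)) :=
        lintegral_mono hpt
      _ = _ := by
        rw [lintegral_add_right _ measurable_const]; simp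
  have hle : ∀ {T : ℝ≥0∞}, T ≤ S → ((F.vertexWeight β ν v)⁻¹ * T) ^ (1 / p) ≤
      ((F.vertexWeight β ν v)⁻¹.toNNReal : ℝ≥0∞) ^ (1 / p) * S ^ (1 / p) := by
    intro T hT
    rw [ENNReal.coe_toNNReal (ENNReal.inv_ne_top.2 (F.vertexWeight_ne_zero hν β v)),
      ← ENNReal.mul_rpow_of_nonneg _ _ hp0]
    gcongr
  have h2 := (F.lintegral_edge_le hε hp hν hν' habs h).trans (hle le_self_add)
  have h3 := (F.lintegral_edge_le hε hp hν hν' hg.1 h).trans (hle (T := ∫⁻ x, g x ^ p ∂F.mu ε β ν)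
    le_add_self)
  refine h1.trans ((add_le_add h2 (mul_le_mul_right h3 _)).trans_eq ?_)
  rw [ENNReal.coe_mul, ENNReal.coe_add, ENNReal.coe_one, ENNReal.coe_rpow_of_nonneg _ hp0]
  ring

end HyperbolicFilling

/-! ### A discrete Hardy inequality -/

section Hardy

/-- Hölder's inequality with respect to the weights `w`, obtained from finite partial sums. -/
theorem ENNReal.tsum_mul_rpow_le {ι : Type*} {p : ℝ} (hp : 1 ≤ p) (w f : ι → ℝ≥0∞) :
    (∑' i, w i * f i) ^ p ≤ (∑' i, w i) ^ (p - 1) * ∑' i, w i * f i ^ p := by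
  have hp0 : 0 < p := by linarith
  have h1 : ∑' i, w i * f i ≤ (∑' i, w i) ^ (1 - p⁻¹) * (∑' i, w i * f i ^ p) ^ p⁻¹ := by
    rw [ENNReal.tsum_eq_iSup_sum]
    refine iSup_le fun s => (ENNReal.inner_le_weight_mul_Lp_of_nonneg s hp w f).trans ?_
    have h2 : 0 ≤ 1 - p⁻¹ := sub_nonneg.2 (inv_le_one_of_one_le₀ hp)
    gcongr <;> exact ENNReal.sum_le_tsum s
  refine (ENNReal.rpow_le_rpow h1 hp0.le).trans_eq ?_
  rw [ENNReal.mul_rpow_of_nonneg _ _ hp0.le, ← ENNReal.rpow_mul, ← ENNReal.rpow_mul,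
    inv_mul_cancel₀ hp0.ne', ENNReal.rpow_one, sub_mul, inv_mul_cancel₀ hp0.ne', one_mul]

/-- Write `Q^m = Q^{-j} Q^{m+j}` inside the tail, so that it becomes a geometrically weighted sum.
Apply Hölder to the summable weights `Q^{-j}` and exchange the sums; for each `j`, the shifted sum
over `m` is at most the full sum. -/
theorem ENNReal.tsum_pow_mul_tail_rpow_le {p : ℝ} (hp : 1 ≤ p) {Q : ℝ≥0∞} (hQ : 1 < Q)
    (hQ' : Q ≠ ⊤) (G : ℕ → ℝ≥0∞) :
    ∑' m, (Q ^ m * ∑' j, G (m + j) ^ (1 / p)) ^ p ≤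
      (∑' j, Q⁻¹ ^ j) ^ p * ∑' k, (Q ^ k) ^ p * G k := by
  have hp0 : 0 < p := by linarith
  have hQ0 : Q ≠ 0 := (one_pos.trans hQ).ne'
  have h1 : ∀ m, Q ^ m * ∑' j, G (m + j) ^ (1 / p) =
      ∑' j, Q⁻¹ ^ j * (Q ^ (m + j) * G (m + j) ^ (1 / p)) := by
    intro m
    rw [← ENNReal.tsum_mul_left]
    refine tsum_congr fun j => ?_
    rw [← mul_assoc, pow_add, mul_left_comm, ← mul_pow, ENNReal.inv_mul_cancel hQ0 hQ', one_pow,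
      mul_one]
  have h2 : ∀ k, (Q ^ k * G k ^ (1 / p)) ^ p = (Q ^ k) ^ p * G k := by
    intro k
    rw [ENNReal.mul_rpow_of_nonneg _ _ hp0.le, ← ENNReal.rpow_mul, one_div_mul_cancel hp0.ne',
      ENNReal.rpow_one]
  calc ∑' m, (Q ^ m * ∑' j, G (m + j) ^ (1 / p)) ^ p
      ≤ ∑' m, (∑' j, Q⁻¹ ^ j) ^ (p - 1) *
          ∑' j, Q⁻¹ ^ j * ((Q ^ (m + j)) ^ p * G (m + j)) := by
        refine ENNReal.tsum_le_tsum fun m => ?_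
        rw [h1]
        refine (ENNReal.tsum_mul_rpow_le hp _ _).trans_eq ?_
        simp only [h2]
    _ = (∑' j, Q⁻¹ ^ j) ^ (p - 1) *
          ∑' j, Q⁻¹ ^ j * ∑' m, ((Q ^ (m + j)) ^ p * G (m + j)) := by
        rw [ENNReal.tsum_mul_left, ENNReal.tsum_comm]
        simp only [ENNReal.tsum_mul_left]
    _ ≤ (∑' j, Q⁻¹ ^ j) ^ (p - 1) * ∑' j, Q⁻¹ ^ j * ∑' k, (Q ^ k) ^ p * G k := by
        refine mul_le_mul_right (ENNReal.tsum_le_tsum fun j => mul_le_mul_right ?_ _) _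
        exact ENNReal.tsum_comp_le_tsum_of_injective (add_left_injective j)
          (fun k => (Q ^ k) ^ p * G k)
    _ = (∑' j, Q⁻¹ ^ j) ^ p * ∑' k, (Q ^ k) ^ p * G k := by
        rw [ENNReal.tsum_mul_right, ← mul_assoc]
        congr 1
        nth_rewrite 2 [← ENNReal.rpow_one (∑' j, Q⁻¹ ^ j)]
        rw [← ENNReal.rpow_add_of_nonneg _ _ (by linarith) zero_le_one, sub_add_cancel]

/-- Truncated subtraction sends each of the first `l` indices to `0`; each such term is at most the
whole sum, and the remaining terms form the sum itself. -/
theorem ENNReal.tsum_comp_sub_le (f : ℕ → ℝ≥0∞) (l : ℕ) :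
    ∑' n, f (n - l) ≤ (l + 1) * ∑' n, f n := by
  rw [← Summable.sum_add_tsum_nat_add' (f := fun n => f (n - l)) (k := l) ENNReal.summable]
  have h1 : ∑ i ∈ Finset.range l, f (i - l) ≤ l * ∑' n, f n := by
    calc _ ≤ ∑ _i ∈ Finset.range l, ∑' n, f n := Finset.sum_le_sum fun i _ => ENNReal.le_tsum _
      _ = l * ∑' n, f n := by simp
  simp only [Nat.add_sub_cancel]
  rw [add_mul, one_mul]
  gcongr

theorem ENNReal.tsum_inv_pow_ne_top {Q : ℝ≥0∞} (hQ : 1 < Q) : ∑' j, Q⁻¹ ^ j ≠ ⊤ := by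
  rw [ENNReal.tsum_geometric]
  exact ENNReal.inv_ne_top.2 (tsub_pos_of_lt (ENNReal.inv_lt_one.2 hQ)).ne'

end Hardy

namespace HyperbolicFilling

variable {Z : Type*} [MetricSpace Z] {α τ : ℝ} (F : HyperbolicFilling Z α τ)

/-! ### Averages over the levels of the filling -/

section Averages

variable [CompactSpace Z]

/-- Finitely many balls of half the separation radius cover `Z`, and each contains at most one point
of `A n`. -/
theorem finite_A (n : ℕ) : (F.A n).Finite := by
  have hα := F.alpha_pos
  have hr : 0 < (α ^ n)⁻¹ / 2 := by positivity
  obtain ⟨t, ht, hcov⟩ := Metric.totallyBounded_iff.1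
    (isCompact_univ (X := Z)).totallyBounded _ hr
  have h1 : ∀ z : Z, ∃ y ∈ t, dist z y < (α ^ n)⁻¹ / 2 := fun z => by
    simpa using hcov (mem_univ z)
  choose f hf hfd using h1
  refine Finite.of_injOn (f := f) (t := t) (fun z _ => hf z) (fun x hx y hy hxy => ?_) ht
  by_contra hne
  have h2 := (F.A_maximal n).1 hx hy hne
  have h3 := dist_triangle_right x y (f x)
  have h4 := hfd x
  have h5 := hfd y
  rw [← hxy] at h5
  simp only at h2
  linarith

open Classical in
-- The sum now filters a fixed finite set, so dependence on `ζ` is only through ball membership. The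
-- default `0` is never taken, since the index lies in `A n`.
theorem avg_eq (ε : ℝ) (u : F.Unif ε → ℝ) (n : ℕ) (ζ : Z) :
    F.avg ε u n ζ =
      (∑ z ∈ (F.finite_A n).toFinset with z ∈ Metric.ball ζ (α ^ n)⁻¹,
        if h : z ∈ F.A n then u (F.vertexPt ε ⟨(z, n), h⟩) else 0) /
      ((F.finite_A n).toFinset.filter fun z => z ∈ Metric.ball ζ (α ^ n)⁻¹).card := by
  have h0 : F.near n ζ =
      ↑((F.finite_A n).toFinset.filter fun z => z ∈ Metric.ball ζ (α ^ n)⁻¹) := by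
    ext z; simp [near]
  unfold avg
  congr 1
  · rw [← finsum_mem_coe_finset, ← h0, ← finsum_set_coe_eq_finsum_mem]
    exact finsum_congr fun z => by rw [dif_pos z.2.1]
  · rw [h0, Set.ncard_coe_finset]

theorem abs_avg_sub_le {ε : ℝ} {u : F.Unif ε → ℝ} {n : ℕ} {ζ : Z} {c D : ℝ}
    (h : ∀ v : F.Vertex, v.1.2 = n → dist v.1.1 ζ < (α ^ n)⁻¹ → |u (F.vertexPt ε v) - c| ≤ D) :
    |F.avg ε u n ζ - c| ≤ D := by
  classical
  rw [avg_eq]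
  set S := (F.finite_A n).toFinset.filter fun z => z ∈ Metric.ball ζ (α ^ n)⁻¹ with hS
  -- Maximality of `A n` ensures that the average is not a division by zero.
  have hne : S.Nonempty := by
    obtain ⟨z, hz, hd⟩ := F.exists_mem_dist_lt n ζ
    exact ⟨z, by simp [hS, hz, hd]⟩
  have hpos : (0 : ℝ) < S.card := by exact_mod_cast hne.card_pos
  rw [div_sub' hpos.ne', abs_div, abs_of_pos hpos, div_le_iff₀ hpos, ← nsmul_eq_mul,
    ← Finset.sum_const, ← Finset.sum_sub_distrib]
  refine (Finset.abs_sum_le_sum_abs _ _).trans ?_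
  rw [mul_comm, ← nsmul_eq_mul]
  refine Finset.sum_le_card_nsmul _ _ _ fun z hz => ?_
  simp only [hS, Finset.mem_filter, Finite.mem_toFinset, Metric.mem_ball] at hz
  rw [dif_pos hz.1]
  exact h ⟨(z, n), hz.1⟩ rfl hz.2

theorem edist_avg_le {ε : ℝ} {u : F.Unif ε → ℝ} {n m : ℕ} {ζ ξ : Z} {D : ℝ≥0∞}
    (h : ∀ v w : F.Vertex, v.1.2 = n → dist v.1.1 ζ < (α ^ n)⁻¹ →
      w.1.2 = m → dist w.1.1 ξ < (α ^ m)⁻¹ →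
        ENNReal.ofReal |u (F.vertexPt ε v) - u (F.vertexPt ε w)| ≤ D) :
    edist (F.avg ε u n ζ) (F.avg ε u m ξ) ≤ D := by
  rcases eq_or_ne D ⊤ with rfl | hD
  · exact le_top
  rw [edist_dist, Real.dist_eq]
  refine ENNReal.ofReal_le_of_le_toReal (F.abs_avg_sub_le fun v hv hvd => ?_)
  rw [abs_sub_comm]
  refine F.abs_avg_sub_le fun w hw hwd => ?_
  rw [abs_sub_comm]
  exact (ENNReal.ofReal_le_iff_le_toReal hD).1 (h v w hv hvd hw hwd)

theorem avg_zero (ε : ℝ) (u : F.Unif ε → ℝ) (ζ : Z) :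
    F.avg ε u 0 ζ = u (F.vertexPt ε F.root) := by
  rw [← sub_eq_zero, ← abs_nonpos_iff]
  refine F.abs_avg_sub_le fun v hv _ => ?_
  have : v = F.root := by
    obtain ⟨⟨z, n⟩, hz⟩ := v
    obtain rfl : n = 0 := hv
    obtain rfl : z = F.z₀ := by simpa [F.A_zero] using hz
    rfl
  rw [this, sub_self, abs_zero]

theorem measurable_avg [MeasurableSpace Z] [BorelSpace Z] (ε : ℝ) (u : F.Unif ε → ℝ) (n : ℕ) :
    Measurable (F.avg ε u n) := by
  classical
  have hm : ∀ z : Z, MeasurableSet {ζ : Z | z ∈ Metric.ball ζ (α ^ n)⁻¹} := fun z => by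
    have : {ζ : Z | z ∈ Metric.ball ζ (α ^ n)⁻¹} = Metric.ball z (α ^ n)⁻¹ := by
      ext ζ; exact Metric.mem_ball_comm
    rw [this]
    exact measurableSet_ball
  have h0 : F.avg ε u n = fun ζ => _ := funext fun ζ => F.avg_eq ε u n ζ
  rw [h0]
  simp only [Finset.sum_filter, Finset.card_filter, Nat.cast_sum]
  refine Measurable.div ?_ ?_ <;> refine Finset.measurable_fun_sum _ fun z _ => ?_
  · exact Measurable.ite (hm z) measurable_const measurable_const
  · exact measurable_from_top.comp (Measurable.ite (hm z) measurable_const measurable_const)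

end Averages

/-! ### The level sums dominating the oscillation of the averages -/

section LevelSums

/-- The sum of `|U v - U w|^p` over the neighbors `w` of `v`. -/
noncomputable def edgeSum (p : ℝ) (U : F.Vertex → ℝ) (v : F.Vertex) : ℝ≥0∞ :=
  ∑' w : {w // F.graph.Adj v w}, ENNReal.ofReal |U v - U w.1| ^ p

/-- The sum of `edgeSum` over the vertices `(z, n)` with `ζ ∈ B(z, α⁻ⁿ)`. -/
noncomputable def levelSum (p : ℝ) (U : F.Vertex → ℝ) (n : ℕ) (ζ : Z) : ℝ≥0∞ :=
  ∑' z : F.A n, (Metric.ball z.1 (α ^ n)⁻¹).indicator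
    (fun _ => F.edgeSum p U ⟨(z.1, n), z.2⟩) ζ

/-- The tail sums of the `p`-th roots of the level sums. -/
noncomputable def tailSum (p : ℝ) (U : F.Vertex → ℝ) (n : ℕ) (ζ : Z) : ℝ≥0∞ :=
  ∑' j, F.levelSum p U (n + j) ζ ^ (1 / p)

/-- The vertices are the disjoint union of the levels. -/
def vertexEquiv : F.Vertex ≃ Σ n, F.A n where
  toFun v := ⟨v.1.2, v.1.1, v.2⟩
  invFun x := ⟨(x.2.1, x.1), x.2.2⟩
  left_inv _ := rfl
  right_inv _ := rfl

variable {F}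

/-- The `p`-th power of the left side is a single term of `edgeSum` at `v`, which is itself a single
term of `levelSum` at `ζ`. The same bound thus serves steps between levels and steps within a level.
-/
theorem ofReal_abs_sub_le_levelSum {p : ℝ} (hp : 1 ≤ p) (U : F.Vertex → ℝ) {n : ℕ} {ζ : Z}
    {v w : F.Vertex} (hv : v.1.2 = n) (hvζ : dist v.1.1 ζ < (α ^ n)⁻¹)
    (hvw : v = w ∨ F.graph.Adj v w) :
    ENNReal.ofReal |U v - U w| ≤ F.levelSum p U n ζ ^ (1 / p) := by
  rcases hvw with rfl | h
  · simp
  have hp0 : 0 < p := by linarith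
  subst hv
  rw [one_div, ENNReal.le_rpow_inv_iff hp0]
  calc ENNReal.ofReal |U v - U w| ^ p ≤ F.edgeSum p U v :=
        ENNReal.le_tsum (f := fun w : {w // F.graph.Adj v w} => ENNReal.ofReal |U v - U w.1| ^ p)
          ⟨w, h⟩
    _ = (Metric.ball v.1.1 (α ^ v.1.2)⁻¹).indicator (fun _ => F.edgeSum p U v) ζ := by
        rw [indicator_of_mem]
        rwa [Metric.mem_ball, dist_comm]
    _ ≤ F.levelSum p U v.1.2 ζ :=
        ENNReal.le_tsum (f := fun z : F.A v.1.2 => (Metric.ball z.1 (α ^ v.1.2)⁻¹).indicator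
          (fun _ => F.edgeSum p U ⟨(z.1, v.1.2), z.2⟩) ζ) ⟨v.1.1, v.2⟩

theorem levelSum_rpow_le_tailSum (p : ℝ) (U : F.Vertex → ℝ) (n : ℕ) (ζ : Z) :
    F.levelSum p U n ζ ^ (1 / p) ≤ F.tailSum p U n ζ :=
  ENNReal.le_tsum (f := fun j => F.levelSum p U (n + j) ζ ^ (1 / p)) 0

variable [CompactSpace Z]

theorem edist_avg_succ_le {p : ℝ} (hp : 1 ≤ p) {ε : ℝ} (u : F.Unif ε → ℝ) (n : ℕ) (ζ : Z) :
    edist (F.avg ε u n ζ) (F.avg ε u (n + 1) ζ) ≤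
      F.levelSum p (fun v => u (F.vertexPt ε v)) n ζ ^ (1 / p) :=
  F.edist_avg_le fun _ _ hv hvd hw hwd => ofReal_abs_sub_le_levelSum hp
    (fun v => u (F.vertexPt ε v)) hv hvd (Or.inr (F.adj_of_level_succ hv hw hvd hwd))

theorem edist_avg_le_levelSum {p : ℝ} (hp : 1 ≤ p) {ε : ℝ} (u : F.Unif ε → ℝ) {n : ℕ} {ζ ξ : Z}
    (h : n = 0 ∨ dist ζ ξ ≤ (τ - 1) * (α ^ n)⁻¹) :
    edist (F.avg ε u n ζ) (F.avg ε u n ξ) ≤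
      F.levelSum p (fun v => u (F.vertexPt ε v)) n ζ ^ (1 / p) := by
  rcases h with rfl | h
  · simp [avg_zero]
  · exact F.edist_avg_le fun _ _ hv hvd hw hwd => ofReal_abs_sub_le_levelSum hp
      (fun v => u (F.vertexPt ε v)) hv hvd (F.eq_or_adj_of_dist_lt hv hw hvd hwd h)

theorem tendsto_avg_of_tailSum_ne_top {p : ℝ} (hp : 1 ≤ p) {ε : ℝ} {u : F.Unif ε → ℝ} {ζ : Z}
    (h : F.tailSum p (fun v => u (F.vertexPt ε v)) 0 ζ ≠ ⊤) :
    Tendsto (fun n => F.avg ε u n ζ) atTop (𝓝 (F.trace ε u ζ)) := by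
  have h1 : CauchySeq fun n => F.avg ε u n ζ := by
    refine cauchySeq_of_edist_le_of_tsum_ne_top _ (edist_avg_succ_le hp u · ζ) ?_
    simpa [tailSum] using h
  exact h1.tendsto_limUnder

theorem edist_avg_trace_le {p : ℝ} (hp : 1 ≤ p) {ε : ℝ} {u : F.Unif ε → ℝ} {ζ : Z}
    (h : F.tailSum p (fun v => u (F.vertexPt ε v)) 0 ζ ≠ ⊤) (n : ℕ) :
    edist (F.avg ε u n ζ) (F.trace ε u ζ) ≤ F.tailSum p (fun v => u (F.vertexPt ε v)) n ζ :=
  edist_le_tsum_of_edist_le_of_tendsto _ (edist_avg_succ_le hp u · ζ)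
    (tendsto_avg_of_tailSum_ne_top hp h) n

/-- The chain descends from the boundary to level `n` above `ζ`, crosses within that level, and
returns to `ξ`. The crossing costs one term of the tail at `ζ`, which explains the factor `2`. At
level `0` the crossing is free, as both averages equal the value at the root. -/
theorem edist_trace_le {p : ℝ} (hp : 1 ≤ p) {ε : ℝ} {u : F.Unif ε → ℝ} {ζ ξ : Z}
    (hζ : F.tailSum p (fun v => u (F.vertexPt ε v)) 0 ζ ≠ ⊤)
    (hξ : F.tailSum p (fun v => u (F.vertexPt ε v)) 0 ξ ≠ ⊤) {n : ℕ}
    (h : n = 0 ∨ dist ζ ξ ≤ (τ - 1) * (α ^ n)⁻¹) :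
    edist (F.trace ε u ζ) (F.trace ε u ξ) ≤
      2 * F.tailSum p (fun v => u (F.vertexPt ε v)) n ζ +
        F.tailSum p (fun v => u (F.vertexPt ε v)) n ξ := by
  refine (edist_triangle4 _ (F.avg ε u n ζ) (F.avg ε u n ξ) _).trans ?_
  rw [two_mul, edist_comm (F.trace ε u ζ)]
  exact add_le_add (add_le_add (edist_avg_trace_le hp hζ n)
    ((edist_avg_le_levelSum hp u h).trans (levelSum_rpow_le_tailSum _ _ _ _)))
    (edist_avg_trace_le hp hξ n)

variable [MeasurableSpace Z] [BorelSpace Z]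

theorem measurable_levelSum (p : ℝ) (U : F.Vertex → ℝ) (n : ℕ) : Measurable (F.levelSum p U n) := by
  have := (F.finite_A n).countable.to_subtype
  exact Measurable.tsum fun z => measurable_const.indicator measurableSet_ball

theorem measurable_tailSum (p : ℝ) (U : F.Vertex → ℝ) (n : ℕ) : Measurable (F.tailSum p U n) :=
  Measurable.tsum fun _ => (measurable_levelSum p U _).pow_const _

theorem lintegral_levelSum (p : ℝ) (U : F.Vertex → ℝ) (n : ℕ) (ν : Measure Z) :
    ∫⁻ ζ, F.levelSum p U n ζ ∂ν =
      ∑' z : F.A n, ν (Metric.ball z.1 (α ^ n)⁻¹) * F.edgeSum p U ⟨(z.1, n), z.2⟩ := by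
  have := (F.finite_A n).countable.to_subtype
  unfold levelSum
  rw [lintegral_tsum fun z => (measurable_const.indicator measurableSet_ball).aemeasurable]
  refine tsum_congr fun z => ?_
  rw [lintegral_indicator measurableSet_ball, setLIntegral_const, mul_comm]

/-- Integrating the indicators in `levelSum` produces the ball masses in `energy`. This is the
passage from sums over vertices to functions on `Z`. -/
theorem lintegral_tsum_levelSum (p s : ℝ) (U : F.Vertex → ℝ) (ν : Measure Z) :
    ∫⁻ ζ, ∑' k, (ENNReal.ofReal (α ^ s) ^ k) ^ p * F.levelSum p U k ζ ∂ν = F.energy p s ν U := by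
  rw [lintegral_tsum fun k => ((measurable_levelSum p U k).const_mul _).aemeasurable]
  simp only [lintegral_const_mul _ (measurable_levelSum p U _), lintegral_levelSum,
    ← ENNReal.tsum_mul_left]
  rw [energy, ← F.vertexEquiv.symm.tsum_eq, ENNReal.tsum_sigma']
  rfl

/-- Hardy's inequality for the tail sums. -/
theorem lintegral_tsum_tailSum_le {p : ℝ} (hp : 1 ≤ p) {s : ℝ} (hs : 0 < s) (U : F.Vertex → ℝ)
    (ν : Measure Z) :
    ∫⁻ ζ, ∑' m, (ENNReal.ofReal (α ^ s) ^ m * F.tailSum p U m ζ) ^ p ∂ν ≤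
      (∑' j, (ENNReal.ofReal (α ^ s))⁻¹ ^ j) ^ p * F.energy p s ν U := by
  rw [← lintegral_tsum_levelSum, ← lintegral_const_mul]
  · refine lintegral_mono fun ζ => ?_
    exact ENNReal.tsum_pow_mul_tail_rpow_le hp
      (by rw [ENNReal.one_lt_ofReal]; exact Real.one_lt_rpow F.one_lt_alpha hs)
      ENNReal.ofReal_ne_top _
  · exact Measurable.tsum fun k => (measurable_levelSum p U k).const_mul _

end LevelSums

end HyperbolicFilling

/-! ### Balls under a doubling measure -/

section Doubling

variable {Z : Type*} [MetricSpace Z] [MeasurableSpace Z]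

theorem IsDoublingMeasure.measure_ball_ne_zero {ν : Measure Z} (hν : IsDoublingMeasure ν) (z : Z)
    (r : ℝ) (hr : r > 0) : ν (Metric.ball z r) ≠ 0 := by
  obtain ⟨C, hC⟩ := hν
  have := (hC z (r / 2) (by linarith)).1
  rw [mul_div_cancel₀ r two_ne_zero] at this
  exact this.ne'

theorem IsDoublingMeasure.measure_ball_ne_top {ν : Measure Z} (hν : IsDoublingMeasure ν) (z : Z)
    (r : ℝ) : ν (Metric.ball z r) ≠ ⊤ := by
  obtain ⟨C, hC⟩ := hν
  rcases le_or_gt r 0 with hr | hr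
  · simp [Metric.ball_eq_empty.2 hr]
  · exact (hC z r hr).2.2.ne

theorem IsDoublingMeasure.exists_measure_ball_mul_le {ν : Measure Z} (hν : IsDoublingMeasure ν)
    (c : ℝ) : ∃ D : ℝ≥0, ∀ (z : Z) (r : ℝ), 0 < r →
      ν (Metric.ball z (c * r)) ≤ D * ν (Metric.ball z r) := by
  obtain ⟨C, hC⟩ := hν
  obtain ⟨k, hk⟩ := pow_unbounded_of_one_lt c (one_lt_two (α := ℝ))
  have key : ∀ (k : ℕ) (z : Z) (r : ℝ), 0 < r →
      ν (Metric.ball z (2 ^ k * r)) ≤ (C : ℝ≥0∞) ^ k * ν (Metric.ball z r) := by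
    intro k
    induction k with
    | zero => simp
    | succ k ih =>
      intro z r hr
      rw [pow_succ', mul_assoc, pow_succ', mul_assoc]
      exact (hC z _ (by positivity)).2.1.trans (mul_le_mul_right (ih z r hr) _)
  refine ⟨C ^ k, fun z r hr => (measure_mono (Metric.ball_subset_ball ?_)).trans
    ((key k z r hr).trans_eq (by rw [ENNReal.coe_pow]))⟩
  gcongr

/-- The balls of radius `r` are the slices of an open set in `Z × Z`. -/
theorem measurable_measure_ball [OpensMeasurableSpace Z] [SecondCountableTopology Z]
    (ν : Measure Z) [SFinite ν] (r : ℝ) : Measurable fun z => ν (Metric.ball z r) := by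
  have hs : MeasurableSet {q : Z × Z | dist q.2 q.1 < r} :=
    (isOpen_lt (continuous_snd.dist continuous_fst) continuous_const).measurableSet
  exact measurable_measure_prodMk_left hs

end Doubling

namespace HyperbolicFilling

variable {Z : Type*} [MetricSpace Z] {α τ : ℝ} {F : HyperbolicFilling Z α τ}
variable [MeasurableSpace Z]

/-! ### The discrete trace theorem -/

section Kernel

variable [BorelSpace Z] (ν : Measure Z)

/-- Auxiliary kernel: the mean value kernel of scale `α⁻ⁿ`, weighted by `f`. -/
noncomputable def ballKernel (α : ℝ) (f : ℕ → Z → ℝ≥0∞) (n : ℕ) (ζ ξ : Z) : ℝ≥0∞ :=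
  (Metric.ball ζ (2 * (α ^ n)⁻¹)).indicator
    (fun _ => f n ζ / ν (Metric.ball ζ (2 * (α ^ n)⁻¹))) ξ

theorem measurable_ballKernel [SecondCountableTopology Z] [SFinite ν] {f : ℕ → Z → ℝ≥0∞} (hf : ∀ n, Measurable (f n)) (n : ℕ) :
    Measurable fun q : Z × Z => ballKernel ν α f n q.1 q.2 := by
  have hs : MeasurableSet {q : Z × Z | dist q.2 q.1 < 2 * (α ^ n)⁻¹} :=
    (isOpen_lt (continuous_snd.dist continuous_fst) continuous_const).measurableSet
  have h1 : Measurable fun q : Z × Z => f n q.1 / ν (Metric.ball q.1 (2 * (α ^ n)⁻¹)) :=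
    ((hf n).div (measurable_measure_ball ν _)).comp measurable_fst
  exact h1.indicator hs

theorem lintegral_ballKernel_le (f : ℕ → Z → ℝ≥0∞) (n : ℕ) (ζ : Z) :
    ∫⁻ ξ, ballKernel ν α f n ζ ξ ∂ν ≤ f n ζ := by
  unfold ballKernel
  rw [lintegral_indicator measurableSet_ball, setLIntegral_const]
  rw [mul_comm]
  exact ENNReal.mul_div_le

/-- In the variable `ξ` the kernel centered at `ζ` has integral at most `f n ζ`. The kernel centered
at `ξ` reduces to this by Tonelli, hence the factor `2`. -/
theorem lintegral_lintegral_tsum_ballKernel_le [SecondCountableTopology Z] [SFinite ν] {f : ℕ → Z → ℝ≥0∞}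
    (hf : ∀ n, Measurable (f n)) :
    ∫⁻ ζ, ∫⁻ ξ, ((∑' n, ballKernel ν α f n ζ ξ) + ∑' n, ballKernel ν α f n ξ ζ) ∂ν ∂ν ≤
      2 * ∫⁻ ζ, ∑' n, f n ζ ∂ν := by
  have hk := fun n => measurable_ballKernel (α := α) ν hf n
  have hm : Measurable fun q : Z × Z => ∑' n, ballKernel ν α f n q.1 q.2 := Measurable.tsum hk
  have h1 : ∫⁻ ζ, ∫⁻ ξ, (∑' n, ballKernel ν α f n ζ ξ) ∂ν ∂ν ≤ ∫⁻ ζ, ∑' n, f n ζ ∂ν := by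
    refine lintegral_mono fun ζ => ?_
    have hζ : ∀ n, Measurable (ballKernel ν α f n ζ) := fun n =>
      (hk n).comp measurable_prodMk_left
    rw [lintegral_tsum fun n => (hζ n).aemeasurable]
    exact ENNReal.tsum_le_tsum fun n => lintegral_ballKernel_le ν f n ζ
  have h2 : ∫⁻ ζ, ∫⁻ ξ, (∑' n, ballKernel ν α f n ξ ζ) ∂ν ∂ν ≤ ∫⁻ ζ, ∑' n, f n ζ ∂ν := by
    rw [lintegral_lintegral_swap]
    · exact h1
    · exact (hm.comp measurable_swap).aemeasurable
  rw [two_mul]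
  refine le_trans (le_of_eq ?_) (add_le_add h1 h2)
  rw [← lintegral_add_left hm.lintegral_prod_right']
  refine lintegral_congr fun ζ => ?_
  have hζ : Measurable fun ξ => ∑' n, ballKernel ν α f n ζ ξ := hm.comp measurable_prodMk_left
  rw [lintegral_add_left hζ]

end Kernel

section Trace

variable [CompactSpace Z]

/-- From `α^{n+1} d > 1` follows `α^{(n+1)s} d^s ≥ 1`, and `d ≤ 1` with `θ ≤ s` allows `d^s` to be
replaced by the larger `d^θ`. -/
theorem one_le_pow_mul_rpow {α s θ p d : ℝ} (hα : 1 < α) (hp : 0 < p) (hθ : 0 < θ) (hθs : θ ≤ s)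
    {n : ℕ} (hd : (α ^ (n + 1))⁻¹ < d) (hd1 : d ≤ 1) :
    1 ≤ (ENNReal.ofReal (α ^ s) ^ (n + 1)) ^ p * ENNReal.ofReal d ^ (p * θ) := by
  have hα0 : 0 < α := one_pos.trans hα
  have hd0 : 0 < d := lt_trans (by positivity) hd
  rw [mul_comm p θ, ENNReal.rpow_mul, ← ENNReal.mul_rpow_of_nonneg _ _ hp.le]
  refine ENNReal.one_le_rpow ?_ hp
  rw [ENNReal.ofReal_rpow_of_pos hd0, ← ENNReal.ofReal_pow (by positivity),
    ← ENNReal.ofReal_mul (by positivity), ENNReal.one_le_ofReal]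
  have h1 : d ^ s ≤ d ^ θ := Real.rpow_le_rpow_of_exponent_ge hd0 hd1 hθs
  calc (1 : ℝ) ≤ (α ^ (n + 1) * d) ^ s := by
        refine Real.one_le_rpow ?_ (hθ.le.trans hθs)
        have := mul_lt_mul_of_pos_left hd (pow_pos hα0 (n + 1))
        rw [mul_inv_cancel₀ (pow_pos hα0 _).ne'] at this
        exact this.le
    _ = (α ^ s) ^ (n + 1) * d ^ s := by
        rw [Real.mul_rpow (by positivity) hd0.le, ← Real.rpow_natCast, ← Real.rpow_natCast,
          ← Real.rpow_mul hα0.le, ← Real.rpow_mul hα0.le, mul_comm s]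
    _ ≤ (α ^ s) ^ (n + 1) * d ^ θ := by gcongr

theorem two_mul_add_rpow_le {p : ℝ} (hp : 0 ≤ p) (a b : ℝ≥0∞) :
    (2 * a + b) ^ p ≤ 3 ^ p * (a ^ p + b ^ p) := by
  have h1 : 2 * a + b ≤ 3 * max a b := by
    calc 2 * a + b ≤ 2 * max a b + max a b := by gcongr; exacts [le_max_left _ _, le_max_right _ _]
      _ = 3 * max a b := by ring
  refine (ENNReal.rpow_le_rpow h1 hp).trans ?_
  rw [ENNReal.mul_rpow_of_nonneg _ _ hp]
  gcongr
  rcases le_total a b with h | h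
  · rw [max_eq_right h]; exact le_add_self
  · rw [max_eq_left h]; exact le_self_add

/-- Pointwise estimate of the Besov integrand of the trace. -/
theorem besov_integrand_le {p s θ : ℝ} (hp : 1 ≤ p) (hθ : 0 < θ) (hθs : θ ≤ s) {ν : Measure Z}
    (hν : IsDoublingMeasure ν) {D : ℝ≥0}
    (hD : ∀ (z : Z) (r : ℝ), 0 < r → ν (Metric.ball z (4 * α * r)) ≤ D * ν (Metric.ball z r))
    {l : ℕ} (hl : (α ^ l)⁻¹ ≤ τ - 1) {ε : ℝ} {u : F.Unif ε → ℝ} {ζ ξ : Z}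
    (hζ : F.tailSum p (fun v => u (F.vertexPt ε v)) 0 ζ ≠ ⊤)
    (hξ : F.tailSum p (fun v => u (F.vertexPt ε v)) 0 ξ ≠ ⊤) (hne : ζ ≠ ξ) (hdist : dist ζ ξ ≤ 1)
    {f : ℕ → Z → ℝ≥0∞} (hf : f = fun n ζ =>
      (ENNReal.ofReal (α ^ s) ^ n * F.tailSum p (fun v => u (F.vertexPt ε v)) (n - l) ζ) ^ p) :
    ENNReal.ofReal |F.trace ε u ζ - F.trace ε u ξ| ^ p /
      (ENNReal.ofReal (dist ζ ξ) ^ (p * θ) * ν (Metric.ball ζ (dist ζ ξ))) ≤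
    (3 ^ p * ENNReal.ofReal (α ^ s) ^ p * D) *
      ((∑' n, ballKernel ν α f n ζ ξ) + ∑' n, ballKernel ν α f n ξ ζ) := by
  have hα1 := F.one_lt_alpha
  have hα := F.alpha_pos
  have hp0 : 0 < p := by linarith
  have hd0 : 0 < dist ζ ξ := dist_pos.2 hne
  -- The scale of the pair: `α^{-(n+1)} < d(ζ, ξ) ≤ α^{-n}`.
  obtain ⟨n, hn1, hn2⟩ := exists_nat_pow_near_of_lt_one hd0 hdist (inv_pos.2 hα)
    (inv_lt_one_of_one_lt₀ hα1)
  rw [inv_pow] at hn1 hn2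
  set Q := ENNReal.ofReal (α ^ s) with hQ
  set H := F.tailSum p (fun v => u (F.vertexPt ε v)) with hH
  have hpos : 0 < (α ^ n)⁻¹ := by positivity
  have hpos1 : 0 < (α ^ (n + 1))⁻¹ := by positivity
  have hR : α * (α ^ (n + 1))⁻¹ = (α ^ n)⁻¹ := by
    rw [pow_succ]; field_simp
  -- Going `l` levels up makes the two points close relative to `τ - 1`. If `n ≤ l`, truncated
  -- subtraction gives the root level, where closeness is not needed.
  have hclose : n - l = 0 ∨ dist ζ ξ ≤ (τ - 1) * (α ^ (n - l))⁻¹ := by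
    refine or_iff_not_imp_left.2 fun h0 => hn2.trans ?_
    have : α ^ n = α ^ l * α ^ (n - l) := by rw [← pow_add]; congr 1; omega
    rw [this, mul_inv]
    gcongr
  have h1 : ENNReal.ofReal |F.trace ε u ζ - F.trace ε u ξ| ^ p ≤
      3 ^ p * (H (n - l) ζ ^ p + H (n - l) ξ ^ p) := by
    rw [← Real.dist_eq, ← edist_dist]
    exact (ENNReal.rpow_le_rpow (edist_trace_le hp hζ hξ hclose) hp0.le).trans
      (two_mul_add_rpow_le hp0.le _ _)
  set B := ν (Metric.ball ζ (dist ζ ξ)) with hB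
  have hB0 : B ≠ 0 := hν.measure_ball_ne_zero _ _ hd0
  have hBt : B ≠ ⊤ := hν.measure_ball_ne_top _ _
  -- Radius `4 α⁻ⁿ` is `4α` times `α^{-(n+1)} < d(ζ, ξ)`, and this ball contains the balls of radius
  -- `2 α⁻ⁿ` about both `ζ` and `ξ`.
  have hbase : ν (Metric.ball ζ (4 * (α ^ n)⁻¹)) ≤ D * B := by
    have := hD ζ _ hpos1
    rw [mul_assoc, hR] at this
    exact this.trans (mul_le_mul_right (measure_mono (Metric.ball_subset_ball hn1.le)) _)
  have hb1 : ν (Metric.ball ζ (2 * (α ^ n)⁻¹)) ≤ D * B :=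
    (measure_mono (Metric.ball_subset_ball (by linarith))).trans hbase
  have hb2 : ν (Metric.ball ξ (2 * (α ^ n)⁻¹)) ≤ D * B := by
    refine (measure_mono (Metric.ball_subset_ball' ?_)).trans hbase
    rw [dist_comm]; linarith
  have hk : ∀ x y : Z, dist y x < 2 * (α ^ n)⁻¹ → ν (Metric.ball x (2 * (α ^ n)⁻¹)) ≤ D * B →
      H (n - l) x ^ p * (Q ^ n) ^ p * B⁻¹ ≤ D * ∑' n, ballKernel ν α f n x y := by
    intro x y hxy hx
    have e1 : f n x / ν (Metric.ball x (2 * (α ^ n)⁻¹)) ≤ ∑' n, ballKernel ν α f n x y := by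
      refine le_trans (le_of_eq ?_) (ENNReal.le_tsum n)
      rw [ballKernel, indicator_of_mem (Metric.mem_ball.2 hxy)]
    have e2 : B⁻¹ ≤ D * (ν (Metric.ball x (2 * (α ^ n)⁻¹)))⁻¹ := by
      have hx0 := hν.measure_ball_ne_zero x (2 * (α ^ n)⁻¹) (by positivity)
      have hxt := hν.measure_ball_ne_top x (2 * (α ^ n)⁻¹)
      rw [← div_eq_mul_inv, ENNReal.le_div_iff_mul_le (Or.inl hx0) (Or.inl hxt), mul_comm,
        ← div_eq_mul_inv]
      exact ENNReal.div_le_of_le_mul hx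
    calc H (n - l) x ^ p * (Q ^ n) ^ p * B⁻¹
        ≤ H (n - l) x ^ p * (Q ^ n) ^ p * (D * (ν (Metric.ball x (2 * (α ^ n)⁻¹)))⁻¹) := by gcongr
      _ = D * (f n x / ν (Metric.ball x (2 * (α ^ n)⁻¹))) := by
        rw [hf, div_eq_mul_inv]
        simp only
        rw [ENNReal.mul_rpow_of_nonneg _ _ hp0.le]
        ring
      _ ≤ _ := by gcongr
  have hkζ := hk ζ ξ (by rw [dist_comm]; linarith) hb1
  have hkξ := hk ξ ζ (by linarith) hb2
  -- The lower bound for the distance is at scale `n + 1`; the surplus factor is the `Q ^ p` of the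
  -- final constant.
  have hd : (ENNReal.ofReal (dist ζ ξ) ^ (p * θ))⁻¹ ≤ (Q ^ (n + 1)) ^ p := by
    rw [← one_div]
    exact ENNReal.div_le_of_le_mul (one_le_pow_mul_rpow hα1 hp0 hθ hθs hn1 hdist)
  have hd1 : ENNReal.ofReal (dist ζ ξ) ^ (p * θ) ≠ 0 := by
    simp [ENNReal.rpow_eq_zero_iff, not_le.2 hd0]
  rw [div_eq_mul_inv, ENNReal.mul_inv (Or.inr hBt) (Or.inr hB0)]
  calc _ ≤ (3 ^ p * (H (n - l) ζ ^ p + H (n - l) ξ ^ p)) * ((Q ^ (n + 1)) ^ p * B⁻¹) := by gcongr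
    _ = 3 ^ p * Q ^ p * (H (n - l) ζ ^ p * (Q ^ n) ^ p * B⁻¹ +
          H (n - l) ξ ^ p * (Q ^ n) ^ p * B⁻¹) := by
      rw [pow_succ, ENNReal.mul_rpow_of_nonneg _ _ hp0.le]
      ring
    _ ≤ 3 ^ p * Q ^ p * (D * (∑' n, ballKernel ν α f n ζ ξ) +
          D * ∑' n, ballKernel ν α f n ξ ζ) := by gcongr
    _ = _ := by ring

variable [BorelSpace Z]

/-- The term `m = 0` of Hardy's inequality bounds the integral of `tailSum p U 0 ^ p`. -/
theorem ae_tailSum_ne_top {p : ℝ} (hp : 1 ≤ p) {s : ℝ} (hs : 0 < s) {U : F.Vertex → ℝ}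
    {ν : Measure Z} (hE : F.energy p s ν U ≠ ⊤) : ∀ᵐ ζ ∂ν, F.tailSum p U 0 ζ ≠ ⊤ := by
  have hp0 : 0 < p := by linarith
  have h1 := lintegral_tsum_tailSum_le hp hs U ν
  have h2 : ∫⁻ ζ, F.tailSum p U 0 ζ ^ p ∂ν ≠ ⊤ := by
    refine ne_top_of_le_ne_top (ENNReal.mul_ne_top (ENNReal.rpow_ne_top_of_nonneg hp0.le
      (ENNReal.tsum_inv_pow_ne_top ?_)) hE) (le_trans (lintegral_mono fun ζ => ?_) h1)
    · rw [ENNReal.one_lt_ofReal]; exact Real.one_lt_rpow F.one_lt_alpha hs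
    · refine le_trans (le_of_eq ?_) (ENNReal.le_tsum 0)
      simp
  filter_upwards [ae_lt_top ((measurable_tailSum p U 0).pow_const p) h2] with ζ hζ h0
  rw [h0, ENNReal.top_rpow_of_pos hp0] at hζ
  exact absurd hζ (lt_irrefl _)

/-- The trace theorem in terms of the discrete energy. -/
theorem exists_trace_estimate (hdiam : Metric.diam (univ : Set Z) < 1) {ν : Measure Z}
    (hν : IsDoublingMeasure ν) (F : HyperbolicFilling Z α τ) {p s θ : ℝ} (hp : 1 ≤ p) (hθ : 0 < θ)
    (hθs : θ ≤ s) (ε : ℝ) :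
    ∃ C : ℝ≥0, ∀ u : F.Unif ε → ℝ, F.energy p s ν (fun v => u (F.vertexPt ε v)) ≠ ⊤ →
      (∀ᵐ ζ ∂ν, Tendsto (fun n => F.avg ε u n ζ) atTop (𝓝 (F.trace ε u ζ))) ∧
      AEStronglyMeasurable (F.trace ε u) ν ∧
      besovSeminorm θ p ν (F.trace ε u) ≤
        C * F.energy p s ν (fun v => u (F.vertexPt ε v)) ^ (1 / p) ∧
      eLpNorm (F.trace ε u) (ENNReal.ofReal p) ν ≤ C * (ENNReal.ofReal |u (F.vertexPt ε F.root)| +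
        F.energy p s ν (fun v => u (F.vertexPt ε v)) ^ (1 / p)) := by
  have hp0 : 0 < p := by linarith
  have hs : 0 < s := hθ.trans_le hθs
  have hα1 := F.one_lt_alpha
  have hdist : ∀ ζ ξ : Z, dist ζ ξ < 1 := fun ζ ξ => (Metric.dist_le_diam_of_mem
    isCompact_univ.isBounded (mem_univ _) (mem_univ _)).trans_lt hdiam
  have : SecondCountableTopology Z := EMetric.secondCountable_of_sigmaCompact Z
  have hfin : IsFiniteMeasure ν := by
    refine ⟨?_⟩
    have : (univ : Set Z) = Metric.ball F.z₀ 1 := (eq_univ_of_forall fun z => hdist z _).symm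
    rw [this]
    exact (hν.measure_ball_ne_top _ _).lt_top
  obtain ⟨D, hD⟩ := hν.exists_measure_ball_mul_le (4 * α)
  obtain ⟨l, hl⟩ := exists_pow_lt_of_lt_one (sub_pos.2 F.one_lt_tau) (inv_lt_one_of_one_lt₀ hα1)
  rw [inv_pow] at hl
  set Q := ENNReal.ofReal (α ^ s) with hQ
  have hQ1 : 1 < Q := by
    rw [hQ, ENNReal.one_lt_ofReal]; exact Real.one_lt_rpow hα1 hs
  set W := ∑' j, Q⁻¹ ^ j with hW
  have hWt : W ≠ ⊤ := ENNReal.tsum_inv_pow_ne_top hQ1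
  -- The factors `3 ^ p * Q ^ p * D` come from the pointwise estimate, `2` from Tonelli, `(Q ^ l) ^
  -- p * (l + 1)` from the shift by `l` levels, and `W ^ p` from Hardy's inequality.
  set M : ℝ≥0∞ := 3 ^ p * Q ^ p * D * (2 * ((Q ^ l) ^ p * ((l + 1) * W ^ p))) with hM
  have hMt : M ≠ ⊤ := by
    have h3 : (3 : ℝ≥0∞) ^ p ≠ ⊤ := ENNReal.rpow_ne_top_of_nonneg hp0.le (by simp)
    have hQp : Q ^ p ≠ ⊤ := ENNReal.rpow_ne_top_of_nonneg hp0.le ENNReal.ofReal_ne_top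
    have hQl : (Q ^ l) ^ p ≠ ⊤ := ENNReal.rpow_ne_top_of_nonneg hp0.le
      (ENNReal.pow_ne_top ENNReal.ofReal_ne_top)
    have hWp : W ^ p ≠ ⊤ := ENNReal.rpow_ne_top_of_nonneg hp0.le hWt
    have hl1 : ((l : ℝ≥0∞) + 1) ≠ ⊤ := by simp
    exact ENNReal.mul_ne_top (ENNReal.mul_ne_top (ENNReal.mul_ne_top h3 hQp) ENNReal.coe_ne_top)
      (ENNReal.mul_ne_top (by simp) (ENNReal.mul_ne_top hQl (ENNReal.mul_ne_top hl1 hWp)))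
  have hνt : ν univ ^ (1 / p) ≠ ⊤ :=
    ENNReal.rpow_ne_top_of_nonneg (by positivity) (measure_ne_top ν _)
  have hMp : M ^ (1 / p) ≠ ⊤ := ENNReal.rpow_ne_top_of_nonneg (by positivity) hMt
  -- The three summands serve the Besov seminorm, the `L^p` distance from the trace to the constant
  -- `u(v₀)`, and the norm of that constant.
  refine ⟨(M ^ (1 / p) + W + ν univ ^ (1 / p)).toNNReal, fun u hE => ?_⟩
  rw [ENNReal.coe_toNNReal (ENNReal.add_ne_top.2 ⟨ENNReal.add_ne_top.2 ⟨hMp, hWt⟩, hνt⟩)]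
  set U : F.Vertex → ℝ := fun v => u (F.vertexPt ε v) with hU
  set E := F.energy p s ν U with hEdef
  have hgood := ae_tailSum_ne_top hp hs hE
  have htend : ∀ᵐ ζ ∂ν, Tendsto (fun n => F.avg ε u n ζ) atTop (𝓝 (F.trace ε u ζ)) :=
    hgood.mono fun ζ hζ => tendsto_avg_of_tailSum_ne_top hp hζ
  have hmeas : AEStronglyMeasurable (F.trace ε u) ν :=
    (aemeasurable_of_tendsto_metrizable_ae atTop
      (fun n => (F.measurable_avg ε u n).aemeasurable) htend).aestronglyMeasurable
  have hHardy : ∫⁻ ζ, ∑' m, (Q ^ m * F.tailSum p U m ζ) ^ p ∂ν ≤ W ^ p * E :=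
    lintegral_tsum_tailSum_le hp hs U ν
  refine ⟨htend, hmeas, ?_, ?_⟩
  · have key : ∫⁻ ζ, ∫⁻ ξ in {ζ}ᶜ, ENNReal.ofReal |F.trace ε u ζ - F.trace ε u ξ| ^ p /
        (ENNReal.ofReal (dist ζ ξ) ^ (p * θ) * ν (Metric.ball ζ (dist ζ ξ))) ∂ν ∂ν ≤ M * E := by
      set f : ℕ → Z → ℝ≥0∞ := fun n ζ => (Q ^ n * F.tailSum p U (n - l) ζ) ^ p with hf
      have hfm : ∀ n, Measurable (f n) := fun n =>
        ((measurable_tailSum p U _).const_mul _).pow_const p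
      have hc : 3 ^ p * Q ^ p * (D : ℝ≥0∞) ≠ ⊤ :=
        ENNReal.mul_ne_top (ENNReal.mul_ne_top (ENNReal.rpow_ne_top_of_nonneg hp0.le (by simp))
          (ENNReal.rpow_ne_top_of_nonneg hp0.le ENNReal.ofReal_ne_top)) ENNReal.coe_ne_top
      have hsum : ∀ ζ, ∑' n, f n ζ ≤
          (Q ^ l) ^ p * ((l + 1) * ∑' m, (Q ^ m * F.tailSum p U m ζ) ^ p) := by
        intro ζ
        refine le_trans ?_ (mul_le_mul_right (ENNReal.tsum_comp_sub_le
          (fun m => (Q ^ m * F.tailSum p U m ζ) ^ p) l) _)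
        rw [← ENNReal.tsum_mul_left]
        refine ENNReal.tsum_le_tsum fun n => ?_
        rw [← ENNReal.mul_rpow_of_nonneg _ _ hp0.le, ← mul_assoc, ← pow_add]
        refine ENNReal.rpow_le_rpow (mul_le_mul_left ?_ _) hp0.le
        -- The inequality `n ≤ l + (n - l)` also holds for truncated subtraction.
        exact pow_le_pow_right₀ hQ1.le (by omega)
      calc _ ≤ ∫⁻ ζ, ∫⁻ ξ, (3 ^ p * Q ^ p * D) *
              ((∑' n, ballKernel ν α f n ζ ξ) + ∑' n, ballKernel ν α f n ξ ζ) ∂ν ∂ν := by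
            refine lintegral_mono_ae (hgood.mono fun ζ hζ => ?_)
            refine le_trans (lintegral_mono_ae ?_) (setLIntegral_le_lintegral {ζ}ᶜ _)
            refine (ae_restrict_iff' (measurableSet_singleton ζ).compl).2
              (hgood.mono fun ξ hξ hne => ?_)
            exact besov_integrand_le hp hθ hθs hν hD hl.le hζ hξ (fun h => hne h.symm)
              (hdist ζ ξ).le hf
        _ = (3 ^ p * Q ^ p * D) * ∫⁻ ζ, ∫⁻ ξ,
              ((∑' n, ballKernel ν α f n ζ ξ) + ∑' n, ballKernel ν α f n ξ ζ) ∂ν ∂ν := by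
            rw [← lintegral_const_mul' _ _ hc]
            simp only [lintegral_const_mul' _ _ hc]
        _ ≤ (3 ^ p * Q ^ p * D) * (2 * ((Q ^ l) ^ p * ((l + 1) * (W ^ p * E)))) := by
            refine mul_le_mul_right ((lintegral_lintegral_tsum_ballKernel_le ν hfm).trans
              (mul_le_mul_right ((lintegral_mono hsum).trans ?_) _)) _
            have hQl : (Q ^ l) ^ p ≠ ⊤ := ENNReal.rpow_ne_top_of_nonneg hp0.le
              (ENNReal.pow_ne_top ENNReal.ofReal_ne_top)
            rw [lintegral_const_mul' _ _ hQl, lintegral_const_mul' _ _ (by simp)]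
            gcongr
        _ = M * E := by rw [hM]; ring
    calc besovSeminorm θ p ν (F.trace ε u) ≤ (M * E) ^ (1 / p) :=
          ENNReal.rpow_le_rpow key (by positivity)
      _ = M ^ (1 / p) * E ^ (1 / p) := ENNReal.mul_rpow_of_nonneg _ _ (by positivity)
      _ ≤ _ := by gcongr; rw [add_assoc]; exact le_self_add
  · set c := u (F.vertexPt ε F.root) with hc
    have hpE : ENNReal.ofReal p ≠ 0 := (ENNReal.ofReal_pos.2 hp0).ne'
    have hpR : (ENNReal.ofReal p).toReal = p := ENNReal.toReal_ofReal hp0.le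
    -- The average at level `0` is the constant `c`, so the full tail bounds `|ũ - c|` pointwise
    -- a.e.
    have h1 : eLpNorm (fun ζ => F.trace ε u ζ - c) (ENNReal.ofReal p) ν ≤ W * E ^ (1 / p) := by
      rw [eLpNorm_eq_lintegral_rpow_enorm_toReal hpE ENNReal.ofReal_ne_top, hpR]
      calc _ ≤ (W ^ p * E) ^ (1 / p) := by
            refine ENNReal.rpow_le_rpow (le_trans (lintegral_mono_ae (hgood.mono fun ζ hζ => ?_))
              hHardy) (by positivity)
            refine le_trans ?_ (ENNReal.le_tsum 0)
            rw [pow_zero, one_mul]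
            refine ENNReal.rpow_le_rpow ?_ hp0.le
            have := edist_avg_trace_le hp hζ 0
            rwa [avg_zero, edist_comm, edist_eq_enorm_sub] at this
        _ = W * E ^ (1 / p) := by
            rw [ENNReal.mul_rpow_of_nonneg _ _ (by positivity), ← ENNReal.rpow_mul,
              mul_one_div_cancel hp0.ne', ENNReal.rpow_one]
    have h2 : eLpNorm (fun _ : Z => c) (ENNReal.ofReal p) ν ≤
        ENNReal.ofReal |c| * ν univ ^ (1 / p) := by
      rw [eLpNorm_const' _ hpE ENNReal.ofReal_ne_top, hpR, Real.enorm_eq_ofReal_abs]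
    have h3 : eLpNorm (F.trace ε u) (ENNReal.ofReal p) ν ≤
        eLpNorm (fun ζ => F.trace ε u ζ - c) (ENNReal.ofReal p) ν +
          eLpNorm (fun _ : Z => c) (ENNReal.ofReal p) ν := by
      have := eLpNorm_add_le (μ := ν) (p := ENNReal.ofReal p)
        (hmeas.sub (aestronglyMeasurable_const (b := c))) (aestronglyMeasurable_const (b := c))
        (by rw [ENNReal.one_le_ofReal]; exact hp)
      rw [sub_add_cancel] at this
      exact this
    refine h3.trans ((add_le_add h1 h2).trans ?_)
    rw [mul_add, add_comm, mul_comm (ENNReal.ofReal |c|)]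
    gcongr
    · exact le_add_self
    · rw [add_right_comm]; exact le_add_self

end Trace

end HyperbolicFilling

/-! ### Weak upper gradients and the Newtonian norm -/

section NewtonianNorms

variable {Y : Type*} [MetricSpace Y] [MeasurableSpace Y] {p : ℝ} {μ : Measure Y} {u : Y → EReal}

theorem IsUpperGradient.isWeakUpperGradient (hp : 0 < p) {g : Y → ℝ≥0∞}
    (h : IsUpperGradient u g) : IsWeakUpperGradient p μ u g :=
  ⟨h.1.aemeasurable, fun _ => 0, measurable_const, by simp [ENNReal.zero_rpow_of_pos hp],
    fun γ L hL hγ hn => absurd (h.2 γ L hL hγ) hn⟩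

theorem minimalGradientNorm_le_newtonianNorm (hp : 0 < p) :
    minimalGradientNorm p μ u ≤ newtonianNorm p μ u := by
  unfold newtonianNorm
  rw [one_div, ENNReal.le_rpow_inv_iff hp]
  refine le_trans (le_iInf₂ fun g hg => ?_) le_add_self
  rw [← ENNReal.le_rpow_inv_iff hp, ← one_div]
  exact iInf₂_le g (hg.isWeakUpperGradient hp)

/-- A bound by all weak upper gradients gives a bound by the Newtonian norm. -/
theorem le_mul_newtonianNorm (hp : 0 < p) {a : ℝ≥0∞} {C : ℝ≥0} (hC : C ≠ 0)
    (h : ∀ g, IsWeakUpperGradient p μ u g →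
      a ≤ C * (∫⁻ x, (u x).abs ^ p ∂μ + ∫⁻ x, g x ^ p ∂μ) ^ (1 / p)) :
    a ≤ C * newtonianNorm p μ u := by
  have hC0 : (C : ℝ≥0∞) ≠ 0 := ENNReal.coe_ne_zero.2 hC
  -- Dividing by `C` isolates the infimum on the right, so that it can be tested on each upper
  -- gradient; this needs `C ≠ 0`.
  rw [mul_comm, ← ENNReal.div_le_iff_le_mul (Or.inl hC0) (Or.inl ENNReal.coe_ne_top)]
  unfold newtonianNorm
  rw [one_div, ENNReal.le_rpow_inv_iff hp]
  simp only [ENNReal.add_iInf]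
  refine le_iInf₂ fun g hg => ?_
  rw [← ENNReal.le_rpow_inv_iff hp, ← one_div,
    ENNReal.div_le_iff_le_mul (Or.inl hC0) (Or.inl ENNReal.coe_ne_top), mul_comm]
  exact h g (hg.isWeakUpperGradient hp)

end NewtonianNorms

namespace HyperbolicFilling

variable {Z : Type*} [MetricSpace Z] {α τ : ℝ} {F : HyperbolicFilling Z α τ}

/-- The left side does not depend on the gradient, so the infimum can be taken in `energy_le`. -/
theorem energy_rpow_le_minimalGradientNorm [MeasurableSpace Z] {ε β p : ℝ} (hε : ε = Real.log α)
    (hp : 1 ≤ p) {ν : Measure Z} (hν : ∀ z, ∀ r > 0, ν (Metric.ball z r) ≠ 0)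
    {u : F.Unif ε → EReal} (hu : ∀ x, u x ≠ ⊥ ∧ u x ≠ ⊤) :
    F.energy p (1 - β / (ε * p)) ν (fun v => (u (F.vertexPt ε v)).toReal) ^ (1 / p) ≤
      ENNReal.ofReal (α ^ 2) * minimalGradientNorm p (F.mu ε β ν) u := by
  have hp0 : 0 < p := by linarith
  have hα := F.alpha_pos
  have hA : ENNReal.ofReal (α ^ 2) ≠ 0 := (ENNReal.ofReal_pos.2 (by positivity)).ne'
  rw [mul_comm (ENNReal.ofReal _), ← ENNReal.div_le_iff_le_mul (Or.inl hA) (Or.inl ENNReal.ofReal_ne_top)]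
  refine le_iInf₂ fun g hg => ?_
  rw [ENNReal.div_le_iff_le_mul (Or.inl hA) (Or.inl ENNReal.ofReal_ne_top),
    mul_comm (gradientLpNorm _ _ _)]
  refine (ENNReal.rpow_le_rpow (energy_le hε hp hν hu hg) (by positivity)).trans_eq ?_
  rw [ENNReal.mul_rpow_of_nonneg _ _ (by positivity), ← ENNReal.rpow_mul,
    mul_one_div_cancel hp0.ne', ENNReal.rpow_one, gradientLpNorm]

/-! ### Traces of Lipschitz functions -/

theorem approxVertex_snd (ζ : Z) (n : ℕ) : (F.approxVertex ζ n).1.2 = n := rfl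

theorem dist_approxVertex_lt (ζ : Z) (n : ℕ) :
    dist (F.approxVertex ζ n).1.1 ζ < (α ^ n)⁻¹ :=
  (F.exists_mem_dist_lt n ζ).choose_spec.2

/-- Successive approximating vertices are adjacent, so their `d_ε`-distances decay geometrically.
The `limUnder` in `boundaryMap` is thus a genuine limit. -/
theorem tendsto_boundaryMap {ε : ℝ} (hε : ε = Real.log α) (ζ : Z) :
    Tendsto (fun n => (F.vertexPt ε (F.approxVertex ζ n) : UniformSpace.Completion (F.Unif ε)))
      atTop (𝓝 (F.boundaryMap ε ζ)) := by
  refine CauchySeq.tendsto_limUnder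
    (cauchySeq_of_le_geometric α⁻¹ (α ^ 2) (inv_lt_one_of_one_lt₀ F.one_lt_alpha) fun n => ?_)
  rw [UniformSpace.Completion.dist_eq, inv_pow]
  exact F.dist_vertexPt_le hε (F.adj_of_level_succ (approxVertex_snd ζ n)
    (approxVertex_snd ζ (n + 1)) (dist_approxVertex_lt ζ n) (dist_approxVertex_lt ζ (n + 1)))

/-- All vertices averaged at level `n` are equal or adjacent to `approxVertex ζ n`, so the average
differs from the value there by at most `K α² α⁻ⁿ`. Those values converge by continuity of the
extension. -/
theorem tendsto_avg_of_lipschitzWith [CompactSpace Z] {ε : ℝ} (hε : ε = Real.log α)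
    {w : F.Unif ε → ℝ} {K : ℝ≥0} (hw : LipschitzWith K w) (ζ : Z) :
    Tendsto (fun n => F.avg ε w n ζ) atTop
      (𝓝 (UniformSpace.Completion.extension w (F.boundaryMap ε ζ))) := by
  have hα := F.alpha_pos
  have h1 : Tendsto (fun n => w (F.vertexPt ε (F.approxVertex ζ n))) atTop
      (𝓝 (UniformSpace.Completion.extension w (F.boundaryMap ε ζ))) := by
    have := ((UniformSpace.Completion.continuous_extension (f := w)).tendsto
      (F.boundaryMap ε ζ)).comp (tendsto_boundaryMap hε ζ)
    refine this.congr fun n => ?_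
    exact UniformSpace.Completion.extension_coe hw.uniformContinuous _
  have h2 : ∀ n, |F.avg ε w n ζ - w (F.vertexPt ε (F.approxVertex ζ n))| ≤
      K * α ^ 2 * α⁻¹ ^ n := by
    intro n
    refine F.abs_avg_sub_le fun v hv hvd => ?_
    have h3 := hw.dist_le_mul (F.vertexPt ε v) (F.vertexPt ε (F.approxVertex ζ n))
    rw [Real.dist_eq] at h3
    refine h3.trans ?_
    rw [mul_assoc, inv_pow]
    refine mul_le_mul_of_nonneg_left ?_ K.coe_nonneg
    rcases F.eq_or_adj_of_dist_lt hv (approxVertex_snd ζ n) hvd (dist_approxVertex_lt ζ n) (by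
      rw [dist_self]
      have := F.one_lt_tau
      exact mul_nonneg (by linarith) (by positivity)) with h | h
    · rw [← h, dist_self]; positivity
    · have h4 := F.dist_vertexPt_le hε h
      rwa [hv] at h4
  have h4 : Tendsto (fun n : ℕ => (K : ℝ) * α ^ 2 * α⁻¹ ^ n) atTop (𝓝 0) := by
    simpa using (tendsto_pow_atTop_nhds_zero_of_lt_one (inv_nonneg.2 hα.le)
      (inv_lt_one_of_one_lt₀ F.one_lt_alpha)).const_mul ((K : ℝ) * α ^ 2)
  have h5 := (squeeze_zero_norm h2 h4).add h1
  simpa using h5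

end HyperbolicFilling

/-! ### The trace theorem -/

theorem theorem10p1 {Z : Type*} [MetricSpace Z] [CompactSpace Z] [MeasurableSpace Z] [BorelSpace Z]
    (hdiam_pos : 0 < Metric.diam (univ : Set Z)) (hdiam_lt : Metric.diam (univ : Set Z) < 1)
    (ν : Measure Z) (hν : IsDoublingMeasure ν)
    {α τ : ℝ} (F : HyperbolicFilling Z α τ)
    (ε β p θ : ℝ) (hε : ε = Real.log α) (hβ : 0 < β) (hp : 1 ≤ p)
    (hθ_pos : 0 < θ) (hθ_le : θ ≤ 1 - β / (ε * p)) :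
    (∃ C : ℝ≥0, ∀ u : F.Unif ε → EReal, MemNewtonian p (F.mu ε β ν) u →
      -- `u` is real-valued, so that the averages below are averages of its values
      (∀ x, u x ≠ ⊥ ∧ u x ≠ ⊤) ∧
      (∀ᵐ ζ ∂ν, Tendsto (fun n => F.avg ε (fun x => (u x).toReal) n ζ) atTop
        (𝓝 (F.trace ε (fun x => (u x).toReal) ζ))) ∧
      MemBesov θ p ν (F.trace ε fun x => (u x).toReal) ∧
      besovSeminorm θ p ν (F.trace ε fun x => (u x).toReal) ≤
        C * minimalGradientNorm p (F.mu ε β ν) u ∧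
      eLpNorm (F.trace ε fun x => (u x).toReal) (ENNReal.ofReal p) ν ≤
        C * ((u (F.vertexPt ε F.root)).abs + minimalGradientNorm p (F.mu ε β ν) u) ∧
      (u (F.vertexPt ε F.root)).abs + minimalGradientNorm p (F.mu ε β ν) u ≤
        C * newtonianNorm p (F.mu ε β ν) u) ∧
    (∀ (w : F.Unif ε → ℝ) (K : ℝ≥0), LipschitzWith K w →
      ∃ w' : UniformSpace.Completion (F.Unif ε) → ℝ,
        (∃ K' : ℝ≥0, LipschitzWith K' w') ∧ (∀ x : F.Unif ε, w' x = w x) ∧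
        (∀ w'' : UniformSpace.Completion (F.Unif ε) → ℝ, (∃ K'' : ℝ≥0, LipschitzWith K'' w'') →
          (∀ x : F.Unif ε, w'' x = w x) → w'' = w') ∧
        ∀ ζ : Z, Tendsto (fun n => F.avg ε w n ζ) atTop (𝓝 (F.trace ε w ζ)) ∧
          F.trace ε w ζ = w' (F.boundaryMap ε ζ)) := by
  have hp0 : 0 < p := by linarith
  have hα := F.alpha_pos
  refine ⟨?_, fun w K hw => ?_⟩
  · have hν0 := hν.measure_ball_ne_zero
    obtain ⟨C₁, hC₁⟩ := HyperbolicFilling.exists_trace_estimate hdiam_lt hν F hp hθ_pos hθ_le ε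
    obtain ⟨C₂, hC₂⟩ := F.exists_abs_vertexPt_le (β := β) hε hp hν0 hν.measure_ball_ne_top F.root
    set A : ℝ≥0 := Real.toNNReal (α ^ 2) with hA
    -- The first summand serves the two trace bounds, with `A` converting energy to gradient norm
    -- and `1` for the term `|u(v₀)|`. The second serves the last bound: `C₂ + 1` for the root
    -- value, kept nonzero for `le_mul_newtonianNorm`, and `1` for the gradient norm.
    refine ⟨C₁ * (A + 1) + (C₂ + 1 + 1), fun u hu => ?_⟩
    obtain ⟨hum, -, g, hg, hgp⟩ := hu
    have hreal := HyperbolicFilling.ne_bot_ne_top hε hp hν0 hg hgp.ne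
    have hE : F.energy p (1 - β / (ε * p)) ν (fun v => (u (F.vertexPt ε v)).toReal) ≠ ⊤ :=
      ne_top_of_le_ne_top (ENNReal.mul_ne_top (ENNReal.rpow_ne_top_of_nonneg hp0.le
        ENNReal.ofReal_ne_top) hgp.ne) (HyperbolicFilling.energy_le hε hp hν0 hreal hg)
    have hEm := HyperbolicFilling.energy_rpow_le_minimalGradientNorm (β := β) hε hp hν0 hreal
    obtain ⟨h1, h2, h3, h4⟩ := hC₁ (fun x => (u x).toReal) hE
    rw [← EReal.abs_eq_ofReal (hreal _)] at h4
    set N := minimalGradientNorm p (F.mu ε β ν) u with hN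
    set a := (u (F.vertexPt ε F.root)).abs with ha
    have hNt : N ≠ ⊤ := ne_top_of_le_ne_top
      (ENNReal.rpow_ne_top_of_nonneg (by positivity) hgp.ne) (iInf₂_le g hg)
    have hat : a ≠ ⊤ := by
      rw [ha, EReal.abs_eq_ofReal (hreal _)]; exact ENNReal.ofReal_ne_top
    have h3' : besovSeminorm θ p ν (F.trace ε fun x => (u x).toReal) ≤
        (C₁ * (A + 1) + (C₂ + 1 + 1) : ℝ≥0) * N := by
      refine h3.trans ((mul_le_mul_right hEm _).trans ?_)
      rw [← mul_assoc]
      refine mul_le_mul_left ?_ _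
      push_cast
      exact le_trans (mul_le_mul_right le_self_add _) le_self_add
    have h4' : eLpNorm (F.trace ε fun x => (u x).toReal) (ENNReal.ofReal p) ν ≤
        (C₁ * (A + 1) + (C₂ + 1 + 1) : ℝ≥0) * (a + N) := by
      refine h4.trans ((mul_le_mul_right (add_le_add_right hEm _) _).trans ?_)
      calc (C₁ : ℝ≥0∞) * (a + A * N) ≤ C₁ * ((A + 1) * (a + N)) := by
            refine mul_le_mul_right ?_ _
            rw [mul_add, add_mul (A : ℝ≥0∞) 1 a, one_mul]
            exact add_le_add le_add_self (mul_le_mul_left le_self_add _)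
        _ ≤ _ := by
            rw [← mul_assoc]
            refine mul_le_mul_left ?_ _
            push_cast
            exact le_self_add
    refine ⟨hreal, h1, ⟨⟨h2, h4'.trans_lt ?_⟩, h3'.trans_lt ?_⟩, h3', h4', ?_⟩
    · exact ENNReal.mul_lt_top ENNReal.coe_lt_top (ENNReal.add_lt_top.2 ⟨hat.lt_top, hNt.lt_top⟩)
    · exact ENNReal.mul_lt_top ENNReal.coe_lt_top hNt.lt_top
    · have h5 : a ≤ (C₂ + 1 : ℝ≥0) * newtonianNorm p (F.mu ε β ν) u := by
        refine le_mul_newtonianNorm hp0 (by positivity) fun g hg => ?_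
        refine (hC₂ u hum hreal g hg).trans (mul_le_mul_left ?_ _)
        exact_mod_cast le_self_add
      calc a + N ≤ (C₂ + 1 : ℝ≥0) * newtonianNorm p (F.mu ε β ν) u +
            newtonianNorm p (F.mu ε β ν) u :=
          add_le_add h5 (minimalGradientNorm_le_newtonianNorm hp0)
        _ = (C₂ + 1 + 1 : ℝ≥0) * newtonianNorm p (F.mu ε β ν) u := by push_cast; ring
        _ ≤ _ := by
          refine mul_le_mul_left ?_ _
          exact_mod_cast le_add_self
  · refine ⟨UniformSpace.Completion.extension w, ⟨K, hw.completion_extension⟩,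
      fun x => UniformSpace.Completion.extension_coe hw.uniformContinuous x, ?_, fun ζ => ?_⟩
    · rintro w'' ⟨K'', hK''⟩ h
      -- Two continuous functions agreeing on the dense subset `X_ε` of its completion coincide.
      refine UniformSpace.Completion.ext hK''.continuous
        UniformSpace.Completion.continuous_extension fun x => ?_
      rw [h, UniformSpace.Completion.extension_coe hw.uniformContinuous]
    · have h := HyperbolicFilling.tendsto_avg_of_lipschitzWith hε hw ζ
      have h' : F.trace ε w ζ = _ := h.limUnder_eq
      rw [h']
      exact ⟨h, rfl⟩
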